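/- **Setting.** Let $\mathbb D$ be the open unit disk. A one-parameter semigroup is a family $(\phi_t)_{t\ge 0}$ of holomorphic self-maps of $\mathbb D$ with $\phi_0=\mathrm{id}$, $\phi_{s+t}=\phi_s\circ\phi_t$ and $\phi_t(z)\to z$ as $t\to0^+$ for every $z\in\mathbb D$; its infinitesimal generator is the holomorphic function $G$ on $\mathbb D$ with $\frac{d}{dt}\phi_t(z)=G(\phi_t(z))$ for all $z\in\mathbb D$, $t\ge0$. A point $\sigma\in\partial\mathbb D$ is a boundary regular fixed point of $(\phi_t)$ if for every $t\ge0$ the angular limit of $\phi_t$ at $\sigma$ equals $\sigma$ and the angular derivative $\phi_t'(\sigma)$ exists finitely; the spectral value at $\sigma$ is then the angular limit of $G(z)/(\sigma-z)$ as $z\to\sigma$ (a real number). Let $n\ge1$, let $\sigma_1,\dots,\sigma_n\in\partial\mathbb D$ be pairwise distinct, $F=\{\sigma_1,\dots,\sigma_n\}$, and let $\Lambda=(\lambda_1,\dots,\lambda_n)\in(-\infty,0)^n$. Let $\mathrm{Gen}_0(F,\Lambda)$ be the class of infinitesimal generators $G$ of one-parameter semigroups $(\phi_t)$ such that $0$ is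 the Denjoy–Wolff point of every $\phi_t\ne\mathrm{id}$ (so $G\equiv0$ is included) and every $\sigma_k$ is a boundary regular fixed point of $(\phi_t)$ with spectral value $\lambda_k'\in[\lambda_k,0]$. Let $\mathrm{Gen}_0'(F,\Lambda)$ be the subclass in which $\lambda'_k=\lambda_k$ for all $k$. For $G\in\mathrm{Gen}_0(F,\Lambda)$ let $\lambda(G)$ be its spectral value at $0$, i.e. the unique $\lambda\in\mathbb C$ with $\phi_t'(0)=e^{-\lambda t}$ for all $t\ge0$. Put $$r=\Big(\sum_{k=1}^n\frac1{|\lambda_k|}\Big)^{-1},\qquad \Omega=\{\omega\in\mathbb C:|\omega-r|\le r\},\qquad p_0(z)=\sum_{k=1}^n\frac{1}{2|\lambda_k|}\,\frac{\sigma_k+z}{\sigma_k-z},$$ $$\hat\ell_\omega=\frac1\omega-\frac12\sum_{k=1}^n\frac1{|\lambda_k|}\quad(\omega\ne0),$$ $$Z_\omega=\Big\{\zeta\in\mathbb C:\Big|\frac{\zeta}{2\omega^2}-\sum_{k=1}^n\frac{\overline{\sigma_k}}{|\lambda_k|}\Big|\le 2\,\mathrm{Re}\,\frac1\omega-\sum_{k=1}^n\frac1{|\lambda_k|}\Big\}\quad(\omega\in\Omega\setminus\{0\}),\qquad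 Z_0=\{0\}.$$ **Theorem.** 1. The spectral value $\lambda(G)$ is well defined for every $G\in\mathrm{Gen}_0(F,\Lambda)$, and the value region $$\widehat V(F,\Lambda)=\{(G''(0),\lambda(G)):G\in\mathrm{Gen}_0(F,\Lambda)\}\subset\mathbb C^2$$ is equal to $\{(\zeta,\omega)\in\mathbb C^2:\omega\in\Omega,\ \zeta\in Z_\omega\}$. 2. For each boundary point $(\zeta,\omega)$ of $\widehat V(F,\Lambda)$ there is exactly one $G\in\mathrm{Gen}_0(F,\Lambda)$ with $(G''(0),\lambda(G))=(\zeta,\omega)$. It has the form $$\widehat G_{\omega,\sigma}(z)=-\frac{z}{\frac{\sigma+z}{\sigma-z}\,\mathrm{Re}\,\hat\ell_\omega+i\,\mathrm{Im}\,\hat\ell_\omega+p_0(z)}\quad\text{for some }\sigma\in\partial\mathbb D,\ \text{ if }\omega\in\mathrm{int}\,\Omega,$$ $$\widehat G_\omega(z)=-\frac{z}{i\,\mathrm{Im}\,\hat\ell_\omega+p_0(z)}\quad\text{if }\omega\in\partial\Omega\setminus\{0\},\qquad\text{and}\qquad \widehat G_0\equiv0\quad\text{if }\omega=0.$$ Conversely,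 all these functions ($\omega\in\mathrm{int}\,\Omega$, $\sigma\in\partial\mathbb D$; $\omega\in\partial\Omega\setminus\{0\}$; $\omega=0$) belong to $\mathrm{Gen}_0(F,\Lambda)$, have $\lambda(G)=\omega$, and deliver boundary points of $\widehat V(F,\Lambda)$. 3. For every $G\in\mathrm{Gen}_0(F,\Lambda)$, $G\not\equiv0$, one has $\lambda(G)\neq0$ and, with $\lambda=\lambda(G)$, $$\Big|\frac{G''(0)}{2\lambda^2}-\sum_{k=1}^n\frac{\overline{\sigma_k}}{|\lambda_k|}\Big|\le 2\,\mathrm{Re}\,\frac1\lambda-\sum_{k=1}^n\frac1{|\lambda_k|}.$$ This is sharp: for every $\omega\in\Omega\setminus\{0\}$ there is $G\in\mathrm{Gen}'_0(F,\Lambda)$ with $\lambda(G)=\omega$ for which equality holds. -/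

import Mathlib

open Set Filter Topology ComplexConjugate

namespace DiskSemigroup

noncomputable section

/-- The open unit disk of the complex plane. Functions on the disk are represented by functions
`ℂ → ℂ`, of which only the values on `disk` matter. -/
abbrev disk : Set ℂ := Metric.ball 0 1

/-- The Stolz region with vertex `σ` and opening `M` (empty for `M ≤ 1` if `‖σ‖ = 1`). -/
def stolz (σ : ℂ) (M : ℝ) : Set ℂ := {z | z ∈ disk ∧ ‖σ - z‖ < M * (1 - ‖z‖)}

/-- The function `f` has the finite angular (non-tangential) limit `l` at `σ ∈ ∂𝔻`. -/
def HasAngularLimit (f : ℂ → ℂ) (σ l : ℂ) : Prop :=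
  ∀ M : ℝ, Tendsto f (𝓝[stolz σ M] σ) (𝓝 l)

/-- The boundary fixed point `σ` of `f` has the finite angular derivative `d`. -/
def HasAngularDeriv (f : ℂ → ℂ) (σ d : ℂ) : Prop :=
  HasAngularLimit (fun z => (f z - σ) / (z - σ)) σ d

/-- `σ ∈ ∂𝔻` is a boundary regular fixed point (BRFP) of `f`. -/
def IsBRFP (f : ℂ → ℂ) (σ : ℂ) : Prop :=
  ‖σ‖ = 1 ∧ HasAngularLimit f σ σ ∧ ∃ d : ℂ, HasAngularDeriv f σ d

/-- `τ` is the Denjoy-Wolff point of the holomorphic self-map `f ≠ id` of the disk: either the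
fixed point of `f` in the disk, or, if `f` has no fixed points in the disk, the boundary regular
fixed point at which the angular derivative is at most one. -/
def IsDWPoint (f : ℂ → ℂ) (τ : ℂ) : Prop :=
  ¬ EqOn f id disk ∧
    ((τ ∈ disk ∧ f τ = τ) ∨
      ((∀ z ∈ disk, f z ≠ z) ∧ IsBRFP f τ ∧ ∃ d : ℝ, d ≤ 1 ∧ HasAngularDeriv f τ (d : ℂ)))

/-- `(φ t)`, `t ≥ 0`, is a one-parameter semigroup of holomorphic self-maps of the disk. -/
structure IsSemigroup (φ : ℝ → ℂ → ℂ) : Prop where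
  differentiableOn : ∀ t, 0 ≤ t → DifferentiableOn ℂ (φ t) disk
  mapsTo : ∀ t, 0 ≤ t → MapsTo (φ t) disk disk
  zero : ∀ z ∈ disk, φ 0 z = z
  add : ∀ s t, 0 ≤ s → 0 ≤ t → ∀ z ∈ disk, φ (s + t) z = φ s (φ t z)
  tendsto : ∀ z ∈ disk, Tendsto (fun t => φ t z) (𝓝[>] 0) (𝓝 z)

/-- `G` is the infinitesimal generator of the one-parameter semigroup `φ`. -/
structure IsGenerator (G : ℂ → ℂ) (φ : ℝ → ℂ → ℂ) : Prop where
  isSemigroup : IsSemigroup φ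
  differentiableOn : DifferentiableOn ℂ G disk
  hasDeriv : ∀ z ∈ disk, ∀ t, 0 ≤ t →
    HasDerivWithinAt (fun s => φ s z) (G (φ t z)) (Ici 0) t

/-- `τ` is the Denjoy-Wolff point of `φ`, shared by all `φ t ≠ id`; by convention every `τ` is
admitted for the trivial semigroup. -/
def SemigroupDWPoint (φ : ℝ → ℂ → ℂ) (τ : ℂ) : Prop :=
  ∀ t, 0 ≤ t → ¬ EqOn (φ t) id disk → IsDWPoint (φ t) τ

/-- `σ` is a boundary regular fixed point of the semigroup `φ`. -/
def SemigroupBRFP (φ : ℝ → ℂ → ℂ) (σ : ℂ) : Prop := ∀ t, 0 ≤ t → IsBRFP (φ t) σ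

/-- The spectral value at a boundary regular fixed point `σ` of the semigroup generated by `G`
is `μ`, the angular limit of `G z / (σ - z)` at `σ`. -/
def HasBoundarySpectralValue (G : ℂ → ℂ) (σ : ℂ) (μ : ℝ) : Prop :=
  HasAngularLimit (fun z => G z / (σ - z)) σ (μ : ℂ)

/-- The class of generators of semigroups with Denjoy-Wolff point `τ` (including `G = 0`) that have
the boundary regular fixed points `σ k` with spectral values in the intervals `[Λ k, 0]`. -/
def Gen (τ : ℂ) {n : ℕ} (σ : Fin n → ℂ) (Λ : Fin n → ℝ) : Set (ℂ → ℂ) :=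
  {G | ∃ φ, IsGenerator G φ ∧ SemigroupDWPoint φ τ ∧
    ∀ k, SemigroupBRFP φ (σ k) ∧
      ∃ μ : ℝ, Λ k ≤ μ ∧ μ ≤ 0 ∧ HasBoundarySpectralValue G (σ k) μ}

/-- The subclass of `Gen τ σ Λ` in which the spectral values at `σ k` are exactly `Λ k`. -/
def GenExact (τ : ℂ) {n : ℕ} (σ : Fin n → ℂ) (Λ : Fin n → ℝ) : Set (ℂ → ℂ) :=
  {G | ∃ φ, IsGenerator G φ ∧ SemigroupDWPoint φ τ ∧
    ∀ k, SemigroupBRFP φ (σ k) ∧ HasBoundarySpectralValue G (σ k) (Λ k)}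

/-- `l` is the spectral value at the interior Denjoy-Wolff point `τ ∈ 𝔻` of the semigroup `φ`
generated by `G`, that is, `φ_t'(τ) = exp (-l t)` for all `t ≥ 0`. -/
def IsSpectralValue (G : ℂ → ℂ) (τ l : ℂ) : Prop :=
  ∃ φ, IsGenerator G φ ∧
    ∀ t : ℝ, 0 ≤ t → HasDerivAt (φ t) (Complex.exp (-(l * t))) τ

/-- The spectral value of the semigroup generated by `G` at its Denjoy-Wolff point `τ ∈ 𝔻`. -/
def spectralValue (G : ℂ → ℂ) (τ : ℂ) : ℂ := Classical.epsilon (IsSpectralValue G τ)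

/-- The pair `(G''(0), λ(G))` for a generator `G` with Denjoy-Wolff point `0`. -/
def valuePair (G : ℂ → ℂ) : ℂ × ℂ := (iteratedDeriv 2 G 0, spectralValue G 0)

/-- The sum of the numbers `1 / |λ_k|`. -/
def invSum {n : ℕ} (Λ : Fin n → ℝ) : ℝ := ∑ k, |Λ k|⁻¹

/-- The function `p₀ = ∑ α_k (σ_k + z) / (σ_k - z)` with `α_k = |τ - σ_k|² / (2 |λ_k|)`. -/
def pZero (τ : ℂ) {n : ℕ} (σ : Fin n → ℂ) (Λ : Fin n → ℝ) (z : ℂ) : ℂ :=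
  ∑ k, ((‖τ - σ k‖ ^ 2 / (2 * |Λ k|) : ℝ) : ℂ) * ((σ k + z) / (σ k - z))

/-- The closed disk `Ω` of centre and radius `r = (∑ 1 / |λ_k|)⁻¹`. -/
def Omega {n : ℕ} (Λ : Fin n → ℝ) : Set ℂ :=
  {ω | ‖ω - (((invSum Λ)⁻¹ : ℝ) : ℂ)‖ ≤ (invSum Λ)⁻¹}

/-- The closed disk `Z_ω`, with `Z_0 = {0}`. -/
def ZDisk {n : ℕ} (σ : Fin n → ℂ) (Λ : Fin n → ℝ) (ω : ℂ) : Set ℂ :=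
  {ζ | (ω = 0 ∧ ζ = 0) ∨
    (ω ≠ 0 ∧ ‖ζ / (2 * ω ^ 2) - ∑ k, conj (σ k) / ((|Λ k| : ℝ) : ℂ)‖
      ≤ 2 * (1 / ω).re - invSum Λ)}

/-- The value region of `(G''(0), λ(G))` over the class of generators with Denjoy-Wolff
point `0`. -/
def valueRegion {n : ℕ} (σ : Fin n → ℂ) (Λ : Fin n → ℝ) : Set (ℂ × ℂ) :=
  valuePair '' Gen 0 σ Λ

/-- The number `1/ω - (1/2) ∑ 1 / |λ_k|`. -/
def ell {n : ℕ} (Λ : Fin n → ℝ) (ω : ℂ) : ℂ := 1 / ω - ((invSum Λ / 2 : ℝ) : ℂ)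

/-- The extremal function with parameters `ω ∈ int Ω` and `s ∈ ∂𝔻`. -/
def extremalInt {n : ℕ} (σ : Fin n → ℂ) (Λ : Fin n → ℝ) (ω s z : ℂ) : ℂ :=
  -(z / ((s + z) / (s - z) * ((ell Λ ω).re : ℂ) + Complex.I * ((ell Λ ω).im : ℂ)
    + pZero 0 σ Λ z))

/-- The extremal function with parameter `ω ∈ ∂Ω \ {0}`. -/
def extremalBdry {n : ℕ} (σ : Fin n → ℂ) (Λ : Fin n → ℝ) (ω z : ℂ) : ℂ :=
  -(z / (Complex.I * ((ell Λ ω).im : ℂ) + pZero 0 σ Λ z))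

/-- The explicit list of extremal functions `E` that belong to the value `λ(E) = ω`. -/
def IsExtremal {n : ℕ} (σ : Fin n → ℂ) (Λ : Fin n → ℝ) (ω : ℂ) (E : ℂ → ℂ) : Prop :=
  (ω ∈ interior (Omega Λ) ∧ ∃ s : ℂ, ‖s‖ = 1 ∧ E = extremalInt σ Λ ω s) ∨
    (ω ∈ frontier (Omega Λ) ∧ ω ≠ 0 ∧ E = extremalBdry σ Λ ω) ∨
    (ω = 0 ∧ E = fun _ => 0)

end

end DiskSemigroup

namespace DiskSemigroup

/-! The problem reduces to the coefficient estimate `|q'(0)| ≤ 2 Re q(0)` for holomorphic `q` with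
`Re q ≥ 0`.

Since every `φ_t` fixes `0`, Schwarz's lemma gives `Re (z̄ G(z)) ≤ 0`, hence `G = -z p` with `Re p ≥
0` (`berksonPorta`). If `G` is not zero, then `Re p > 0` and `f = 1/p` also has positive real part.
A spectral value `μ` at `σ_k` means that `(1 - r) f(r σ_k) → 1/|μ|`: the Herglotz measure of `f` has
the point mass `1/(2|μ|) ≥ 1/(2|λ_k|)` at `σ_k`. Julia's lemma removes these masses one at a time
(`re_sub_sum_nonneg`), so `q = 1/p - p₀` still has `Re q ≥ 0` and `G = -z/(q + p₀)`
(`exists_repr_of_mem_Gen`).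

The flow satisfies `φ_t'(0) = exp(G'(0) t)`, so `λ(G) = -G'(0) = 1/(q(0) + p₀(0))`. Thus `q(0)` is
the number `ell` at `λ(G)`, and `q'(0)` is `G''(0)/(2λ²)` minus the sum of `conj σ_k/|λ_k|`
(`valuePair_of_repr`). The coefficient estimate becomes the asserted inequality, and equality forces
`q` to be a Möbius map (`eqOn_of_deriv_zero_eq`).

Conversely, each `q(z) = A (1 + cz)/(1 - cz) + iB` with `A ≥ 0`, `|c| ≤ 1` yields a member of the
class (`exists_isGenerator_moebius`): dissipativity makes the trajectories global, and `G` extends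
holomorphically by zero across `σ_k`, a pole of `q + p₀`. Varying `c` fills the disk `Z_ω`; `|c| =
1` gives its boundary circle. -/

/-! ### Global trajectories of dissipative vector fields -/

theorem norm_le_of_hasDerivWithinAt_of_re_nonpos {y y' : ℝ → ℂ}
    (hy : ∀ t, 0 ≤ t → HasDerivWithinAt y (y' t) (Ici 0) t)
    (h : ∀ t, 0 ≤ t → (conj (y t) * y' t).re ≤ 0) {t : ℝ} (ht : 0 ≤ t) : ‖y t‖ ≤ ‖y 0‖ := by
  have hd : ∀ t, 0 ≤ t → HasDerivWithinAt (fun s => ‖y s‖ ^ 2) (2 * (conj (y t) * y' t).re)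
      (Ici 0) t := by
    intro t ht
    have := (hy t ht).norm_sq
    rwa [Complex.inner, mul_comm (y' t)] at this
  have hanti : AntitoneOn (fun s => ‖y s‖ ^ 2) (Ici 0) := by
    refine antitoneOn_of_hasDerivWithinAt_nonpos (convex_Ici 0)
      (fun t ht => (hd t ht).continuousWithinAt) (f' := fun t => 2 * (conj (y t) * y' t).re) ?_ ?_
    · intro t ht
      exact (hd t (interior_subset ht)).mono interior_subset
    · intro t ht
      have := h t (interior_subset ht)
      linarith
  exact le_of_sq_le_sq (hanti (mem_Ici.2 le_rfl) ht ht) (norm_nonneg _)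

/-- For a bounded field Picard–Lindelöf reaches any `[0, T]` in one step; by uniqueness the
solutions for different `T` agree and can be glued. -/
theorem exists_global_solution_of_lipschitz_of_bounded {V : ℂ → ℂ} {K L : NNReal}
    (hK : LipschitzWith K V) (hL : ∀ x, ‖V x‖ ≤ L) (z : ℂ) :
    ∃ y : ℝ → ℂ, y 0 = z ∧ ∀ t, 0 ≤ t → HasDerivWithinAt y (V (y t)) (Ici 0) t := by
  have hloc : ∀ T : ℝ, ∃ y : ℝ → ℂ, 0 ≤ T → y 0 = z ∧
      ∀ t ∈ Icc 0 T, HasDerivWithinAt y (V (y t)) (Icc 0 T) t := by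
    intro T
    by_cases hT : 0 ≤ T
    · have hPL : IsPicardLindelof (fun _ => V) (tmin := 0) (tmax := T) ⟨0, by simp [hT]⟩ z
          (L * T.toNNReal) 0 L K := by
        refine IsPicardLindelof.of_time_independent (fun x _ => hL x) hK.lipschitzOnWith ?_
        simp [hT]
      obtain ⟨y, h0, hy⟩ := hPL.exists_eq_forall_mem_Icc_hasDerivWithinAt₀
      exact ⟨y, fun _ => ⟨h0, hy⟩⟩
    · exact ⟨0, fun h => absurd h hT⟩
  choose Y hY using hloc
  have hIci : ∀ T t : ℝ, 0 ≤ t → t < T →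
      HasDerivWithinAt (Y T) (V (Y T t)) (Ici 0) t := by
    intro T t ht htT
    refine ((hY T (ht.trans htT.le)).2 t ⟨ht, htT.le⟩).mono_of_mem_nhdsWithin ?_
    rw [← Ici_inter_Iic]
    exact inter_mem_nhdsWithin _ (Iic_mem_nhds htT)
  have hagree : ∀ T₁ T₂ s : ℝ, 0 ≤ s → s < T₁ → s < T₂ → Y T₁ s = Y T₂ s := by
    intro T₁ T₂ s hs h1 h2
    have hder : ∀ T, s < T → ∀ t ∈ Icc 0 s, HasDerivWithinAt (Y T) (V (Y T t)) (Ici 0) t :=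
      fun T hT t ht => hIci T t ht.1 (ht.2.trans_lt hT)
    refine ODE_solution_unique (v := fun _ => V) (K := K) (fun _ => hK) (a := 0) (b := s)
      (fun t ht => ((hder T₁ h1 t ht).continuousWithinAt).mono Icc_subset_Ici_self)
      (fun t ht => (hder T₁ h1 t ⟨ht.1, ht.2.le⟩).mono (Ici_subset_Ici.2 ht.1))
      (fun t ht => ((hder T₂ h2 t ht).continuousWithinAt).mono Icc_subset_Ici_self)
      (fun t ht => (hder T₂ h2 t ⟨ht.1, ht.2.le⟩).mono (Ici_subset_Ici.2 ht.1)) ?_ ⟨hs, le_rfl⟩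
    rw [(hY T₁ (hs.trans h1.le)).1, (hY T₂ (hs.trans h2.le)).1]
  -- The `+ 1` keeps `t` strictly inside the interval of the chosen solution, where one-sided
  -- derivatives within `Icc` and `Ici` agree.
  refine ⟨fun t => Y (t + 1) t, ?_, ?_⟩
  · exact (hY (0 + 1) (by norm_num)).1
  · intro t ht
    have heq : ∀ s, 0 ≤ s → s < t + 2 → Y (s + 1) s = Y (t + 2) s := fun s hs hst =>
      hagree _ _ s hs (by linarith) hst
    have := hIci (t + 2) t ht (by linarith)
    rw [← heq t ht (by linarith)] at this
    refine this.congr_of_eventuallyEq ?_ (heq t ht (by linarith))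
    have hmem : Iio (t + 2) ∈ 𝓝[Ici 0] t := mem_nhdsWithin_of_mem_nhds (Iio_mem_nhds (by linarith))
    filter_upwards [self_mem_nhdsWithin, hmem] with s hs hst using heq s hs hst

/-- A cut-off makes the field globally Lipschitz and bounded. Multiplication by `χ ≥ 0` preserves
dissipativity, so the trajectory never leaves the ball of radius `‖z‖`, where the cut-off equals
one. -/
theorem exists_trajectory {G : ℂ → ℂ} (hG : DifferentiableOn ℂ G disk)
    (h : ∀ z ∈ disk, (conj z * G z).re ≤ 0) {z : ℂ} (hz : z ∈ disk) :
    ∃ y : ℝ → ℂ, y 0 = z ∧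
      ∀ t, 0 ≤ t → HasDerivWithinAt y (G (y t)) (Ici 0) t ∧ ‖y t‖ ≤ ‖z‖ := by
  have hz1 : ‖z‖ < 1 := by simpa using hz
  obtain ⟨R, hR, hR1⟩ := exists_between hz1
  have hR0 : 0 < R := (norm_nonneg z).trans_lt hR
  let χ : ContDiffBump (0 : ℂ) := ⟨R, (R + 1) / 2, hR0, by linarith⟩
  let V : ℂ → ℂ := fun w => (χ w : ℝ) • G w
  have hsub : tsupport (χ : ℂ → ℝ) ⊆ disk := by
    rw [χ.tsupport_eq]
    exact Metric.closedBall_subset_ball (show (R + 1) / 2 < 1 by linarith)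
  have hcs : HasCompactSupport V := χ.hasCompactSupport.smul_right
  have hsm : ContDiff ℝ 1 V := by
    refine contDiff_iff_contDiffAt.2 fun w => ?_
    by_cases hw : w ∈ tsupport V
    swap
    · exact contDiffAt_const.congr_of_eventuallyEq (notMem_tsupport_iff_eventuallyEq.1 hw)
    have hw' : w ∈ disk := hsub (tsupport_smul_subset_left _ _ hw)
    have hGw : ContDiffAt ℝ 1 G w :=
      ((hG.contDiffOn Metric.isOpen_ball).contDiffAt (Metric.isOpen_ball.mem_nhds hw')).restrict_scalars ℝ
    exact χ.contDiff.contDiffAt.smul hGw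
  obtain ⟨K, hK⟩ := hsm.lipschitzWith_of_hasCompactSupport hcs one_ne_zero
  obtain ⟨C, hC⟩ := hcs.exists_bound_of_continuous hsm.continuous
  have hL : ∀ x, ‖V x‖ ≤ (C.toNNReal : NNReal) := fun x => (hC x).trans (Real.le_coe_toNNReal C)
  obtain ⟨y, hy0, hy⟩ := exists_global_solution_of_lipschitz_of_bounded hK hL z
  refine ⟨y, hy0, fun t ht => ?_⟩
  have hle : ‖y t‖ ≤ ‖z‖ := by
    rw [← hy0]
    refine norm_le_of_hasDerivWithinAt_of_re_nonpos hy (fun s _ => ?_) ht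
    have : conj (y s) * V (y s) = (χ (y s) : ℝ) * (conj (y s) * G (y s)) := by
      simp only [V, Complex.real_smul]; ring
    rw [this, Complex.re_ofReal_mul]
    by_cases hs : y s ∈ disk
    · exact mul_nonpos_of_nonneg_of_nonpos χ.nonneg (h _ hs)
    · have : χ (y s) = 0 := image_eq_zero_of_notMem_tsupport fun hm => hs (hsub hm)
      simp [this]
  have hone : χ (y t) = 1 := χ.one_of_mem_closedBall (by
    rw [mem_closedBall_zero_iff]; exact hle.trans hR.le)
  have := hy t ht
  exact ⟨by simpa [V, hone] using this, hle⟩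

/-! ### Dependence of solutions on the initial value -/

/-- On a closed ball inside its domain, a holomorphic function satisfies uniform Lipschitz and
second order Taylor estimates. -/
theorem exists_taylor_bounds {v : ℂ → ℂ} {U : Set ℂ} {c : ℂ} {R : ℝ} (hU : IsOpen U)
    (hv : DifferentiableOn ℂ v U) (hR : Metric.closedBall c R ⊆ U) :
    ∃ C L : NNReal, LipschitzOnWith L v (Metric.closedBall c R) ∧
      (∀ b ∈ Metric.closedBall c R, ‖deriv v b‖ ≤ L) ∧
      ∀ a ∈ Metric.closedBall c R, ∀ b ∈ Metric.closedBall c R,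
        ‖v a - v b - deriv v b * (a - b)‖ ≤ C * ‖a - b‖ ^ 2 := by
  have hv1 : DifferentiableOn ℂ (deriv v) U := hv.deriv hU
  have hv2 : DifferentiableOn ℂ (deriv (deriv v)) U := hv1.deriv hU
  have hK := isCompact_closedBall c R
  have hconv := convex_closedBall c R
  obtain ⟨L, hL⟩ := hK.exists_bound_of_continuousOn (hv1.continuousOn.mono hR)
  obtain ⟨C, hC⟩ := hK.exists_bound_of_continuousOn (hv2.continuousOn.mono hR)
  have hL' : ∀ b ∈ Metric.closedBall c R, ‖deriv v b‖ ≤ L.toNNReal := fun b hb =>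
    (hL b hb).trans (Real.le_coe_toNNReal L)
  have hC' : ∀ b ∈ Metric.closedBall c R, ‖deriv (deriv v) b‖ ≤ C.toNNReal := fun b hb =>
    (hC b hb).trans (Real.le_coe_toNNReal C)
  have hda : ∀ b ∈ Metric.closedBall c R, DifferentiableAt ℂ v b := fun b hb =>
    hv.differentiableAt (hU.mem_nhds (hR hb))
  have hda1 : ∀ b ∈ Metric.closedBall c R, DifferentiableAt ℂ (deriv v) b := fun b hb =>
    hv1.differentiableAt (hU.mem_nhds (hR hb))
  have hlip1 := hconv.lipschitzOnWith_of_nnnorm_deriv_le hda1 hC'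
  refine ⟨C.toNNReal, L.toNNReal, hconv.lipschitzOnWith_of_nnnorm_deriv_le hda hL', hL', ?_⟩
  intro a ha b hb
  -- On this convex set `|x - b| ≤ |a - b|`, so the derivative of `v - v'(b) ·` is at most `C |a -
  -- b|`; the mean value inequality supplies the second factor.
  set S := Metric.closedBall c R ∩ Metric.closedBall b ‖a - b‖
  have hS : Convex ℝ S := hconv.inter (convex_closedBall _ _)
  have hd : ∀ x ∈ S, HasDerivWithinAt (fun x => v x - deriv v b * x) (deriv v x - deriv v b) S x := by
    intro x hx
    have h1 := (hda x hx.1).hasDerivAt.sub ((hasDerivAt_id x).const_mul (deriv v b))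
    exact h1.hasDerivWithinAt.congr_deriv (by simp)
  have hb' : ∀ x ∈ S, ‖deriv v x - deriv v b‖ ≤ C.toNNReal * ‖a - b‖ := by
    intro x hx
    refine (hlip1.norm_sub_le hx.1 hb).trans ?_
    gcongr
    simpa [dist_eq_norm] using hx.2
  have := hS.norm_image_sub_le_of_norm_hasDerivWithin_le hd hb'
    (show b ∈ S from ⟨hb, by simp⟩) (show a ∈ S from ⟨ha, by simp [dist_eq_norm]⟩)
  calc ‖v a - v b - deriv v b * (a - b)‖
      = ‖(v a - deriv v b * a) - (v b - deriv v b * b)‖ := by congr 1; ring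
    _ ≤ _ := this
    _ = _ := by ring

theorem norm_solution_sub_le {v : ℂ → ℂ} {S : Set ℂ} {L : NNReal} {T : ℝ}
    (hlip : LipschitzOnWith L v S) {y w : ℝ → ℂ}
    (hy : ∀ t ∈ Icc 0 T, HasDerivWithinAt y (v (y t)) (Ici 0) t) (hyS : ∀ t ∈ Icc 0 T, y t ∈ S)
    (hw : ∀ t ∈ Icc 0 T, HasDerivWithinAt w (v (w t)) (Ici 0) t) (hwS : ∀ t ∈ Icc 0 T, w t ∈ S)
    {t : ℝ} (ht : t ∈ Icc 0 T) : ‖y t - w t‖ ≤ ‖y 0 - w 0‖ * Real.exp (L * t) := by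
  have := dist_le_of_trajectories_ODE_of_mem (v := fun _ => v) (s := fun _ => S) (K := L)
    (a := 0) (b := T) (δ := dist (y 0) (w 0)) (fun _ _ => hlip)
    (fun t ht => ((hy t ht).continuousWithinAt).mono Icc_subset_Ici_self)
    (fun t ht => (hy t ⟨ht.1, ht.2.le⟩).mono (Ici_subset_Ici.2 ht.1))
    (fun t ht => hyS t ⟨ht.1, ht.2.le⟩)
    (fun t ht => ((hw t ht).continuousWithinAt).mono Icc_subset_Ici_self)
    (fun t ht => (hw t ⟨ht.1, ht.2.le⟩).mono (Ici_subset_Ici.2 ht.1))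
    (fun t ht => hwS t ⟨ht.1, ht.2.le⟩) le_rfl t ht
  simpa [dist_eq_norm] using this

/-- Second order expansion of the solutions of an autonomous equation with respect to the initial
value, around a given solution `w`. -/
theorem exists_flow_expansion {v : ℂ → ℂ} {S : Set ℂ} {C L : NNReal} {T : ℝ} (hT : 0 ≤ T)
    (hlip : LipschitzOnWith L v S) (hL : ∀ b ∈ S, ‖deriv v b‖ ≤ L)
    (hC : ∀ a ∈ S, ∀ b ∈ S, ‖v a - v b - deriv v b * (a - b)‖ ≤ C * ‖a - b‖ ^ 2) {w : ℝ → ℂ}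
    (hw : ∀ t ∈ Icc 0 T, HasDerivWithinAt w (v (w t)) (Ici 0) t) (hwS : ∀ t ∈ Icc 0 T, w t ∈ S)
    (hcont : ContinuousOn (deriv v) S) :
    ∃ M : ℝ, ∀ y : ℝ → ℂ,
      (∀ t ∈ Icc 0 T, HasDerivWithinAt y (v (y t)) (Ici 0) t) → (∀ t ∈ Icc 0 T, y t ∈ S) →
      ‖y T - w T - Complex.exp (∫ s in (0 : ℝ)..T, deriv v (w s)) * (y 0 - w 0)‖
        ≤ M * ‖y 0 - w 0‖ ^ 2 := by
  -- Projecting time to `[0, T]` extends the coefficient continuously to the whole line, so its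
  -- primitive is differentiable everywhere.
  set a : ℝ → ℂ := fun s => deriv v (w (projIcc 0 T hT s)) with ha_def
  have hwc : ContinuousOn w (Icc 0 T) := fun t ht =>
    ((hw t ht).continuousWithinAt).mono Icc_subset_Ici_self
  have ha : Continuous a := by
    have h1 : ContinuousOn (fun s => deriv v (w s)) (Icc 0 T) := hcont.comp hwc hwS
    exact h1.comp_continuous (continuous_subtype_val.comp continuous_projIcc) fun s => (projIcc 0 T hT s).2
  have hav : ∀ s ∈ Icc 0 T, a s = deriv v (w s) := fun s hs => by
    simp [ha_def, projIcc_of_mem hT hs]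
  have haL : ∀ s, ‖a s‖ ≤ L := fun s => hL _ (hwS _ (projIcc 0 T hT s).2)
  set I : ℝ → ℂ := fun t => ∫ s in (0 : ℝ)..t, a s with hI
  have hId : ∀ t, HasDerivAt I (a t) t := fun t =>
    intervalIntegral.integral_hasDerivAt_right (ha.intervalIntegrable _ _)
      (ha.stronglyMeasurableAtFilter _ _) ha.continuousAt
  have hIT : I T = ∫ s in (0 : ℝ)..T, deriv v (w s) :=
    intervalIntegral.integral_congr fun s hs => hav s (by rwa [uIcc_of_le hT] at hs)
  have hIL : ∀ t, 0 ≤ t → t ≤ T → ‖I t‖ ≤ L * T := by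
    intro t ht htT
    refine (intervalIntegral.norm_integral_le_of_norm_le_const fun s _ => haL s).trans ?_
    rw [sub_zero, abs_of_nonneg ht]
    gcongr
  have hE : ∀ z : ℂ, ‖z‖ ≤ L * T → ‖Complex.exp z‖ ≤ Real.exp (L * T) := fun z hz => by
    rw [Complex.norm_exp]
    exact Real.exp_le_exp.2 ((Complex.re_le_norm z).trans hz)
  refine ⟨Real.exp (L * T) * (Real.exp (L * T) * (C * Real.exp (L * T) ^ 2) * T), fun y hy hyS => ?_⟩
  set δ := ‖y 0 - w 0‖ with hδ
  -- Integrating factor of the linearised equation: the derivative of `H` contains only the second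
  -- order Taylor remainder.
  set H : ℝ → ℂ := fun t => (y t - w t) * Complex.exp (-I t) with hH
  have hHd : ∀ t ∈ Icc 0 T, HasDerivWithinAt H
      (Complex.exp (-I t) * (v (y t) - v (w t) - deriv v (w t) * (y t - w t))) (Icc 0 T) t := by
    intro t ht
    have h1 := ((hy t ht).sub (hw t ht)).mul ((hId t).neg.cexp.hasDerivWithinAt (s := Ici 0))
    refine (h1.mono Icc_subset_Ici_self).congr_deriv ?_
    rw [hav t ht]
    simp only [Pi.sub_apply, Pi.neg_apply]
    ring
  have hHb : ∀ t ∈ Icc 0 T,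
      ‖Complex.exp (-I t) * (v (y t) - v (w t) - deriv v (w t) * (y t - w t))‖
        ≤ Real.exp (L * T) * (C * Real.exp (L * T) ^ 2) * δ ^ 2 := by
    intro t ht
    rw [norm_mul]
    have h1 := hE (-I t) (by rw [norm_neg]; exact hIL t ht.1 ht.2)
    have h2 := hC _ (hyS t ht) _ (hwS t ht)
    have h3 : ‖y t - w t‖ ≤ δ * Real.exp (L * T) :=
      (norm_solution_sub_le hlip hy hyS hw hwS ht).trans (by
        have := ht.2
        gcongr)
    calc _ ≤ Real.exp (L * T) * (C * (δ * Real.exp (L * T)) ^ 2) := by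
            gcongr
            exact h2.trans (by gcongr)
      _ = _ := by ring
  have hmv := (convex_Icc 0 T).norm_image_sub_le_of_norm_hasDerivWithin_le hHd hHb
    (show (0 : ℝ) ∈ Icc 0 T from ⟨le_rfl, hT⟩) (show T ∈ Icc 0 T from ⟨hT, le_rfl⟩)
  have hH0 : H 0 = y 0 - w 0 := by simp [hH, hI]
  have hfin : y T - w T - Complex.exp (∫ s in (0 : ℝ)..T, deriv v (w s)) * (y 0 - w 0)
      = Complex.exp (I T) * (H T - H 0) := by
    rw [hH0, ← hIT, hH]
    have : Complex.exp (I T) * Complex.exp (-I T) = 1 := by rw [← Complex.exp_add]; simp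
    linear_combination (-(y T - w T)) * this
  rw [hfin, norm_mul]
  calc _ ≤ Real.exp (L * T) * (Real.exp (L * T) * (C * Real.exp (L * T) ^ 2) * δ ^ 2 * ‖T - 0‖) := by
        gcongr
        exact hE _ (hIL T hT le_rfl)
    _ = _ := by rw [sub_zero, Real.norm_of_nonneg hT]; ring

theorem closedBall_zero_subset_disk {R : ℝ} (hR : R < 1) : Metric.closedBall (0 : ℂ) R ⊆ disk :=
  Metric.closedBall_subset_ball hR

theorem hasDerivAt_of_eventually_norm_le {f : ℂ → ℂ} {z₀ e : ℂ} {M : ℝ}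
    (h : ∀ᶠ z in 𝓝 z₀, ‖f z - f z₀ - e * (z - z₀)‖ ≤ M * ‖z - z₀‖ ^ 2) : HasDerivAt f e z₀ := by
  rw [hasDerivAt_iff_isLittleO]
  have h1 : (fun z => f z - f z₀ - (z - z₀) • e) =O[𝓝 z₀] fun z => (z - z₀) ^ 2 := by
    refine Asymptotics.IsBigO.of_bound M ?_
    filter_upwards [h] with z hz
    rw [smul_eq_mul, mul_comm, norm_pow]
    exact hz
  refine h1.trans_isLittleO ?_
  have h2 : (fun z : ℂ => (z - z₀) ^ 2) =o[𝓝 z₀] fun z => (z - z₀) ^ 1 := by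
    have := (Asymptotics.isLittleO_pow_pow (𝕜 := ℂ) (m := 1) (n := 2) (by norm_num)).comp_tendsto
      (show Tendsto (fun z : ℂ => z - z₀) (𝓝 z₀) (𝓝 0) by
        have : Continuous fun z : ℂ => z - z₀ := by fun_prop
        simpa using this.tendsto z₀)
    exact this
  simpa using h2

theorem eq_of_exp_mul_eq {a b : ℂ}
    (h : ∀ t : ℝ, 0 ≤ t → Complex.exp (a * t) = Complex.exp (b * t)) : a = b := by
  have hd : ∀ c : ℂ, HasDerivWithinAt (fun t : ℝ => Complex.exp (c * t)) c (Ici 0) 0 := fun c => by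
    have h1 : HasDerivAt (fun t : ℝ => c * (t : ℂ)) (c * 1) 0 :=
      (Complex.ofRealCLM.hasDerivAt (x := (0 : ℝ))).const_mul c
    simpa using h1.cexp.hasDerivWithinAt (s := Ici 0)
  have h2 := (hd b).congr (fun t ht => h t ht) (h 0 le_rfl)
  exact (uniqueDiffWithinAt_Ici (0 : ℝ)).eq_deriv _ (hd a) h2

/-! ### The semigroup of a dissipative holomorphic field -/

section Flow

variable {G : ℂ → ℂ} {φ : ℝ → ℂ → ℂ}

/-- The exponential solves the variational equation along the trajectory of `z₀`. The quadratic
error makes it a complex derivative, which is how holomorphy of the flow in `z` is obtained. -/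
theorem hasDerivAt_flow (hG : DifferentiableOn ℂ G disk) (h0 : ∀ z ∈ disk, φ 0 z = z)
    (hd : ∀ z ∈ disk, ∀ t, 0 ≤ t → HasDerivWithinAt (fun s => φ s z) (G (φ t z)) (Ici 0) t)
    (hn : ∀ z ∈ disk, ∀ t, 0 ≤ t → ‖φ t z‖ ≤ ‖z‖) {z₀ : ℂ} (hz₀ : z₀ ∈ disk) {T : ℝ}
    (hT : 0 ≤ T) :
    HasDerivAt (φ T) (Complex.exp (∫ s in (0 : ℝ)..T, deriv G (φ s z₀))) z₀ := by
  obtain ⟨R, hR, hR1⟩ := exists_between (mem_ball_zero_iff.1 hz₀)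
  have hsub := closedBall_zero_subset_disk hR1
  obtain ⟨C, L, hlip, hL, hC⟩ := exists_taylor_bounds Metric.isOpen_ball hG hsub
  have hmem : ∀ z, ‖z‖ ≤ R → ∀ t ∈ Icc 0 T, φ t z ∈ Metric.closedBall (0 : ℂ) R := fun z hz t ht =>
    mem_closedBall_zero_iff.2 ((hn z (hsub (mem_closedBall_zero_iff.2 hz)) t ht.1).trans hz)
  obtain ⟨M, hM⟩ := exists_flow_expansion hT hlip hL hC (w := fun s => φ s z₀)
    (fun t ht => hd z₀ hz₀ t ht.1) (hmem z₀ hR.le)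
    ((hG.deriv Metric.isOpen_ball).continuousOn.mono hsub)
  refine hasDerivAt_of_eventually_norm_le (M := M) ?_
  filter_upwards [(continuous_norm.tendsto z₀).eventually (gt_mem_nhds hR)] with z hz
  have hzd : z ∈ disk := mem_ball_zero_iff.2 (hz.trans hR1)
  have := hM (fun s => φ s z) (fun t ht => hd z hzd t ht.1) (hmem z hz.le)
  simpa only [h0 z hzd, h0 z₀ hz₀] using this

theorem IsGenerator.norm_le (hφ : IsGenerator G φ) (hre : ∀ z ∈ disk, (conj z * G z).re ≤ 0)
    {z : ℂ} (hz : z ∈ disk) {t : ℝ} (ht : 0 ≤ t) : ‖φ t z‖ ≤ ‖z‖ := by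
  have := norm_le_of_hasDerivWithinAt_of_re_nonpos (hφ.hasDeriv z hz)
    (fun t ht => hre _ (hφ.isSemigroup.mapsTo t ht hz)) ht
  rwa [hφ.isSemigroup.zero z hz] at this

theorem zero_mem_disk : (0 : ℂ) ∈ disk := Metric.mem_ball_self one_pos

theorem IsGenerator.apply_zero (hφ : IsGenerator G φ) (hre : ∀ z ∈ disk, (conj z * G z).re ≤ 0)
    {t : ℝ} (ht : 0 ≤ t) : φ t 0 = 0 := by
  simpa using hφ.norm_le hre zero_mem_disk ht

theorem IsGenerator.hasDerivAt_zero (hφ : IsGenerator G φ)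
    (hre : ∀ z ∈ disk, (conj z * G z).re ≤ 0) {t : ℝ} (ht : 0 ≤ t) :
    HasDerivAt (φ t) (Complex.exp (deriv G 0 * t)) 0 := by
  have h := hasDerivAt_flow hφ.differentiableOn hφ.isSemigroup.zero hφ.hasDeriv
    (fun z hz t ht => hφ.norm_le hre hz ht) zero_mem_disk ht
  have hint : ∫ s in (0 : ℝ)..t, deriv G (φ s 0) = deriv G 0 * t := by
    rw [intervalIntegral.integral_congr (g := fun _ => deriv G 0)]
    · simp [mul_comm]
    · intro s hs
      rw [uIcc_of_le ht] at hs
      simp only [hφ.apply_zero hre hs.1]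
  rwa [hint] at h

/-- The definition admits any semigroup generated by `G`; the derivative formula at `0` applies to
each of them, so the choice is immaterial. -/
theorem IsGenerator.isSpectralValue_iff (hφ : IsGenerator G φ)
    (hre : ∀ z ∈ disk, (conj z * G z).re ≤ 0) {l : ℂ} :
    IsSpectralValue G 0 l ↔ l = -deriv G 0 := by
  constructor
  · rintro ⟨ψ, hψ, h⟩
    have := eq_of_exp_mul_eq (a := -l) (b := deriv G 0) fun t ht => by
      rw [(hψ.hasDerivAt_zero hre ht).unique (h t ht), neg_mul]
    rw [← this, neg_neg]
  · rintro rfl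
    refine ⟨φ, hφ, fun t ht => ?_⟩
    rw [neg_mul, neg_neg]
    exact hφ.hasDerivAt_zero hre ht

theorem IsGenerator.spectralValue_eq (hφ : IsGenerator G φ)
    (hre : ∀ z ∈ disk, (conj z * G z).re ≤ 0) : spectralValue G 0 = -deriv G 0 := by
  have h : ∃ l, IsSpectralValue G 0 l := ⟨_, (hφ.isSpectralValue_iff hre).2 rfl⟩
  exact (hφ.isSpectralValue_iff hre).1 (Classical.epsilon_spec h)

/-- The semigroup law is uniqueness for the equation: the time-shifted trajectory and the one
restarted at `Y z t` have the same initial value. -/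
theorem exists_isGenerator (hG : DifferentiableOn ℂ G disk)
    (hre : ∀ z ∈ disk, (conj z * G z).re ≤ 0) : ∃ φ, IsGenerator G φ := by
  have hex : ∀ z : ℂ, ∃ y : ℝ → ℂ, z ∈ disk → y 0 = z ∧
      ∀ t, 0 ≤ t → HasDerivWithinAt y (G (y t)) (Ici 0) t ∧ ‖y t‖ ≤ ‖z‖ := by
    intro z
    by_cases hz : z ∈ disk
    · obtain ⟨y, h0, hy⟩ := exists_trajectory hG hre hz
      exact ⟨y, fun _ => ⟨h0, hy⟩⟩
    · exact ⟨0, fun h => absurd h hz⟩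
  choose Y hY using hex
  have h0 : ∀ z ∈ disk, Y z 0 = z := fun z hz => (hY z hz).1
  have hd : ∀ z ∈ disk, ∀ t, 0 ≤ t → HasDerivWithinAt (Y z) (G (Y z t)) (Ici 0) t :=
    fun z hz t ht => ((hY z hz).2 t ht).1
  have hn : ∀ z ∈ disk, ∀ t, 0 ≤ t → ‖Y z t‖ ≤ ‖z‖ := fun z hz t ht => ((hY z hz).2 t ht).2
  have hmaps : ∀ t, 0 ≤ t → ∀ z ∈ disk, Y z t ∈ disk := fun t ht z hz =>
    mem_ball_zero_iff.2 ((hn z hz t ht).trans_lt (mem_ball_zero_iff.1 hz))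
  refine ⟨fun t z => Y z t, ⟨?_, hmaps, h0, ?_, ?_⟩, hG, hd⟩
  · intro t ht z hz
    exact (hasDerivAt_flow (φ := fun t z => Y z t) hG h0 hd hn hz
      ht).differentiableAt.differentiableWithinAt
  · intro s t hs ht z hz
    have hz1 := mem_ball_zero_iff.1 hz
    obtain ⟨C, L, hlip, -, -⟩ := exists_taylor_bounds Metric.isOpen_ball hG
      (closedBall_zero_subset_disk hz1)
    have hsh : ∀ u ∈ Icc 0 s, HasDerivWithinAt (fun u => Y z (u + t)) (G (Y z (u + t))) (Ici 0) u := by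
      intro u hu
      have h1 : HasDerivWithinAt (fun u : ℝ => u + t) 1 (Ici 0) u :=
        ((hasDerivAt_id u).add_const t).hasDerivWithinAt
      have h2 := (hd z hz (u + t) (add_nonneg hu.1 ht)).scomp u h1
        (fun v hv => mem_Ici.2 (add_nonneg hv ht))
      exact h2.congr_deriv (one_smul _ _)
    have := norm_solution_sub_le hlip hsh
      (fun u hu => mem_closedBall_zero_iff.2 (hn z hz _ (add_nonneg hu.1 ht)))
      (fun u hu => hd (Y z t) (hmaps t ht z hz) u hu.1)
      (fun u hu => mem_closedBall_zero_iff.2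
        ((hn (Y z t) (hmaps t ht z hz) u hu.1).trans (hn z hz t ht))) ⟨hs, le_rfl⟩
    rw [zero_add, h0 _ (hmaps t ht z hz), sub_self, norm_zero, zero_mul] at this
    exact sub_eq_zero.1 (norm_le_zero_iff.1 this)
  · intro z hz
    have := (hd z hz 0 le_rfl).continuousWithinAt.tendsto
    rw [h0 z hz] at this
    exact this.mono_left (nhdsWithin_mono _ Ioi_subset_Ici_self)

theorem IsGenerator.semigroupDWPoint (hφ : IsGenerator G φ)
    (hre : ∀ z ∈ disk, (conj z * G z).re ≤ 0) : SemigroupDWPoint φ 0 :=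
  fun _ ht hne => ⟨hne, Or.inl ⟨zero_mem_disk, hφ.apply_zero hre ht⟩⟩

/-! ### Boundary fixed points from holomorphic extension -/

theorem stolz_subset_disk (σ : ℂ) (M : ℝ) : stolz σ M ⊆ disk := fun _ h => h.1

theorem hasAngularLimit_of_tendsto {f : ℂ → ℂ} {σ l : ℂ} (h : Tendsto f (𝓝[disk] σ) (𝓝 l)) :
    HasAngularLimit f σ l :=
  fun M => h.mono_left (nhdsWithin_mono _ (stolz_subset_disk σ M))

/-- A boundary zero of the generator across which it extends holomorphically is a boundary regular
fixed point of the semigroup. -/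
theorem IsGenerator.semigroupBRFP (hφ : IsGenerator G φ) {σ : ℂ} (hσ : ‖σ‖ = 1) {g : ℂ → ℂ}
    {U : Set ℂ} (hU : IsOpen U) (hσU : σ ∈ U) (hg : DifferentiableOn ℂ g U) (hgσ : g σ = 0)
    (hGg : ∀ z ∈ disk, z ∈ U → G z = g z) : SemigroupBRFP φ σ := by
  intro T hT
  obtain ⟨R, hR, hRU⟩ := Metric.nhds_basis_closedBall.mem_iff.1 (hU.mem_nhds hσU)
  obtain ⟨C, L, hlip, hL, hC⟩ := exists_taylor_bounds hU hg hRU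
  have hσR : σ ∈ Metric.closedBall σ R := Metric.mem_closedBall_self hR.le
  -- Interior trajectories are compared with the stationary solution at `σ` of the extended field
  -- `g`.
  obtain ⟨M, hM⟩ := exists_flow_expansion hT hlip hL hC (w := fun _ => σ)
    (fun t _ => by rw [hgσ]; exact hasDerivWithinAt_const _ _ _) (fun _ _ => hσR)
    ((hg.deriv hU).continuousOn.mono hRU)
  set e := Complex.exp (∫ s in (0 : ℝ)..T, deriv g σ)
  have hexp : ∀ᶠ z in 𝓝[disk] σ, ‖φ T z - σ - e * (z - σ)‖ ≤ M * ‖z - σ‖ ^ 2 := by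
    -- With this radius, growth by `exp ((L + 1) T)` still stays within `R`. The rate `L + 1`
    -- instead of `L` gives the strict inequality needed in the barrier argument.
    have hδ : 0 < R * Real.exp (-((L + 1) * T)) := by positivity
    filter_upwards [self_mem_nhdsWithin, mem_nhdsWithin_of_mem_nhds (Metric.ball_mem_nhds σ hδ)]
      with z hz hzδ
    rw [Metric.mem_ball, dist_eq_norm] at hzδ
    have hz0 : 0 < ‖z - σ‖ := by
      rw [norm_pos_iff, sub_ne_zero]
      rintro rfl
      simp [hσ] at hz
    have hd := hφ.hasDeriv z hz
    have hB : ∀ t, t ≤ T → ‖z - σ‖ * Real.exp ((L + 1) * t) ≤ R := by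
      intro t ht
      calc _ ≤ R * Real.exp (-((L + 1) * T)) * Real.exp ((L + 1) * T) := by gcongr
        _ = R := by rw [mul_assoc, ← Real.exp_add]; simp
    have hstay : ∀ ⦃t⦄, t ∈ Icc 0 T → ‖φ t z - σ‖ ≤ ‖z - σ‖ * Real.exp ((L + 1) * t) := by
      refine image_norm_le_of_norm_deriv_right_lt_deriv_boundary (f := fun t => φ t z - σ)
        (f' := fun t => G (φ t z)) (B' := fun t => ‖z - σ‖ * (Real.exp ((L + 1) * t) * (L + 1)))
        ?_ ?_ ?_ ?_ ?_
      · exact fun t ht => (((hd t ht.1).continuousWithinAt).mono Icc_subset_Ici_self).sub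
          continuousWithinAt_const
      · exact fun t ht => ((hd t ht.1).mono (Ici_subset_Ici.2 ht.1)).sub_const σ
      · simp [hφ.isSemigroup.zero z hz]
      · intro t
        have h1 : HasDerivAt (fun t : ℝ => (L + 1 : ℝ) * t) (L + 1) t := by
          simpa using (hasDerivAt_id t).const_mul (L + 1 : ℝ)
        exact h1.exp.const_mul _
      · intro t ht heq
        have hmem : φ t z ∈ Metric.closedBall σ R := by
          rw [Metric.mem_closedBall, dist_eq_norm, heq]
          exact hB t ht.2.le
        rw [hGg _ (hφ.isSemigroup.mapsTo t ht.1 hz) (hRU hmem)]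
        have h1 := hlip.norm_sub_le hmem hσR
        rw [hgσ, sub_zero] at h1
        have h2 : 0 < ‖z - σ‖ * Real.exp ((L + 1) * t) := by positivity
        rw [heq] at h1
        nlinarith
    have hmem : ∀ t ∈ Icc 0 T, φ t z ∈ Metric.closedBall σ R := fun t ht => by
      rw [Metric.mem_closedBall, dist_eq_norm]
      exact (hstay ht).trans (hB t ht.2)
    have := hM (fun s => φ s z) (fun t ht => by
      rw [← hGg _ (hφ.isSemigroup.mapsTo t ht.1 hz) (hRU (hmem t ht))]
      exact hd t ht.1) hmem
    simpa only [hφ.isSemigroup.zero z hz] using this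
  have hne : ∀ᶠ z in 𝓝[disk] σ, z - σ ≠ 0 := by
    filter_upwards [self_mem_nhdsWithin] with z hz
    rw [sub_ne_zero]
    rintro rfl
    simp [hσ] at hz
  have hid : Tendsto (fun z : ℂ => z - σ) (𝓝[disk] σ) (𝓝 0) := by
    have : Continuous fun z : ℂ => z - σ := by fun_prop
    simpa using (this.tendsto σ).mono_left nhdsWithin_le_nhds
  have hquot : Tendsto (fun z => (φ T z - σ) / (z - σ)) (𝓝[disk] σ) (𝓝 e) := by
    rw [tendsto_iff_norm_sub_tendsto_zero]
    have hlim : Tendsto (fun z => M * ‖z - σ‖) (𝓝[disk] σ) (𝓝 0) := by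
      simpa using hid.norm.const_mul M
    refine squeeze_zero' (Eventually.of_forall fun _ => norm_nonneg _) ?_ hlim
    filter_upwards [hexp, hne] with z hz hz0
    have : (φ T z - σ) / (z - σ) - e = (φ T z - σ - e * (z - σ)) / (z - σ) := by
      field_simp
    rw [this, norm_div, div_le_iff₀ (norm_pos_iff.2 hz0)]
    exact hz.trans_eq (by ring)
  refine ⟨hσ, hasAngularLimit_of_tendsto ?_, e, hasAngularLimit_of_tendsto hquot⟩
  have := (hquot.mul hid).add_const σ
  rw [mul_zero, zero_add] at this
  refine this.congr' ?_
  filter_upwards [hne] with z hz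
  field_simp
  ring

end Flow

/-! ### Functions with non-negative real part -/

section HalfPlane

variable {q : ℂ → ℂ}

/-- Open mapping: the image of a nonconstant `q` is open, so it lies in the interior of the closed
half-plane. -/
theorem re_pos_or_const (hq : DifferentiableOn ℂ q disk) (hre : ∀ z ∈ disk, 0 ≤ (q z).re) :
    (∀ z ∈ disk, 0 < (q z).re) ∨ ∃ c, ∀ z ∈ disk, q z = c := by
  rcases (hq.analyticOnNhd Metric.isOpen_ball).is_constant_or_isOpen
    (convex_ball (0 : ℂ) 1).isPreconnected with h | h
  · exact Or.inr h
  · left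
    intro z hz
    have hop := h disk subset_rfl Metric.isOpen_ball
    have hsub : q '' disk ⊆ {w | 0 ≤ w.re} := by
      rintro _ ⟨w, hw, rfl⟩
      exact hre w hw
    have := hop.subset_interior_iff.2 hsub (mem_image_of_mem q hz)
    rwa [Complex.interior_setOfPred_le_re] at this

theorem sq_norm_add_conj_sub_sq_norm_sub (a b : ℂ) :
    ‖b + conj a‖ ^ 2 - ‖b - a‖ ^ 2 = 4 * a.re * b.re := by
  rw [← Complex.normSq_eq_norm_sq, ← Complex.normSq_eq_norm_sq, Complex.normSq_apply,
    Complex.normSq_apply]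
  simp
  ring

theorem add_conj_ne_zero {a b : ℂ} (ha : 0 < a.re) (hb : 0 < b.re) : b + conj a ≠ 0 := by
  intro h
  have := congrArg Complex.re h
  simp at this
  linarith

/-- The Cayley transform of a function with positive real part, normalised at the origin. -/
theorem cayley_props (hq : DifferentiableOn ℂ q disk) (hre : ∀ z ∈ disk, 0 < (q z).re) :
    DifferentiableOn ℂ (fun z => (q z - q 0) / (q z + conj (q 0))) disk ∧
      MapsTo (fun z => (q z - q 0) / (q z + conj (q 0))) disk (Metric.closedBall 0 1) := by
  have h0 := hre 0 zero_mem_disk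
  refine ⟨(hq.sub_const _).div (hq.add_const _) fun z hz => add_conj_ne_zero h0 (hre z hz), ?_⟩
  intro z hz
  rw [mem_closedBall_zero_iff, norm_div]
  refine div_le_one_of_le₀ ?_ (norm_nonneg _)
  refine le_of_sq_le_sq ?_ (norm_nonneg _)
  have h1 := sq_norm_add_conj_sub_sq_norm_sub (q 0) (q z)
  have h2 := mul_pos h0 (hre z hz)
  nlinarith

/-- Schwarz's lemma for the Cayley transform, with the denominator cleared so that imaginary
constants are covered too. -/
theorem norm_sub_le_norm_mul_norm_add_conj (hq : DifferentiableOn ℂ q disk)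
    (hre : ∀ z ∈ disk, 0 ≤ (q z).re) {z : ℂ} (hz : z ∈ disk) :
    ‖q z - q 0‖ ≤ ‖z‖ * ‖q z + conj (q 0)‖ := by
  rcases re_pos_or_const hq hre with h | ⟨c, hc⟩
  · obtain ⟨hd, hm⟩ := cayley_props hq h
    have := Complex.norm_le_norm_of_mapsTo_ball hd hm (by simp) (mem_ball_zero_iff.1 hz)
    rwa [norm_div, div_le_iff₀ (norm_pos_iff.2 (add_conj_ne_zero (h 0 zero_mem_disk) (h z hz)))]
      at this
  · rw [hc z hz, hc 0 zero_mem_disk, sub_self, norm_zero]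
    positivity

/-- This growth bound later excludes the boundary spectral value zero. -/
theorem norm_mul_one_sub_le (hq : DifferentiableOn ℂ q disk) (hre : ∀ z ∈ disk, 0 ≤ (q z).re)
    {z : ℂ} (hz : z ∈ disk) : ‖q z‖ * (1 - ‖z‖) ≤ ‖q 0‖ * (1 + ‖z‖) := by
  have h := norm_sub_le_norm_mul_norm_add_conj hq hre hz
  have h1 := norm_sub_norm_le (q z) (q 0)
  have h2 : ‖q z + conj (q 0)‖ ≤ ‖q z‖ + ‖q 0‖ := by
    simpa using norm_add_le (q z) (conj (q 0))
  nlinarith [norm_nonneg z]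

theorem re_zero_mul_one_sub_le (hq : DifferentiableOn ℂ q disk) (hre : ∀ z ∈ disk, 0 ≤ (q z).re)
    {z : ℂ} (hz : z ∈ disk) : (q 0).re * (1 - ‖z‖) ≤ (q z).re * (1 + ‖z‖) := by
  have h := norm_sub_le_norm_mul_norm_add_conj hq hre hz
  have h0 := hre 0 zero_mem_disk
  have h1 := hre z hz
  have h2 : ‖q z - q 0‖ ^ 2 ≤ ‖z‖ ^ 2 * ‖q z + conj (q 0)‖ ^ 2 := by
    rw [← mul_pow]; gcongr
  have h4 := sq_norm_add_conj_sub_sq_norm_sub (q 0) (q z)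
  have h5 : ‖q z - q 0‖ ^ 2 = ((q z).re - (q 0).re) ^ 2 + ((q z).im - (q 0).im) ^ 2 := by
    rw [Complex.sq_norm, Complex.normSq_apply]
    simp
    ring
  have hz1 : ‖z‖ ^ 2 ≤ 1 := pow_le_one₀ (norm_nonneg _) (mem_ball_zero_iff.1 hz).le
  have h3 : ((q 0).re - (q z).re) ^ 2 ≤ (‖z‖ * ((q z).re + (q 0).re)) ^ 2 := by
    have h6 : ‖q z + conj (q 0)‖ ^ 2
        = ((q z).re + (q 0).re) ^ 2 + ((q z).im - (q 0).im) ^ 2 := by linarith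
    rw [h6, h5] at h2
    nlinarith [mul_nonneg (sub_nonneg.2 hz1) (sq_nonneg ((q z).im - (q 0).im))]
  have := le_of_abs_le (abs_le_of_sq_le_sq h3 (by positivity))
  linarith

/-- Divide the Schwarz estimate by `|z|` and let `z → 0`. -/
theorem norm_deriv_zero_le (hq : DifferentiableOn ℂ q disk) (hre : ∀ z ∈ disk, 0 ≤ (q z).re) :
    ‖deriv q 0‖ ≤ 2 * (q 0).re := by
  have h0 := hre 0 zero_mem_disk
  have hda : DifferentiableAt ℂ q 0 := hq.differentiableAt (Metric.isOpen_ball.mem_nhds zero_mem_disk)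
  have hright : ‖q 0 + conj (q 0)‖ = 2 * (q 0).re := by
    rw [Complex.add_conj, Complex.norm_real, Real.norm_of_nonneg (by positivity)]
  rw [← hright]
  have hlim : Tendsto (fun z => ‖q z + conj (q 0)‖) (𝓝[≠] 0) (𝓝 ‖q 0 + conj (q 0)‖) :=
    ((hda.continuousAt.tendsto.mono_left nhdsWithin_le_nhds).add_const _).norm
  refine le_of_tendsto_of_tendsto hda.hasDerivAt.tendsto_slope.norm hlim ?_
  filter_upwards [self_mem_nhdsWithin,
    mem_nhdsWithin_of_mem_nhds (Metric.isOpen_ball.mem_nhds zero_mem_disk)] with z hz0 hz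
  have := norm_sub_le_norm_mul_norm_add_conj hq hre hz
  rw [slope_def_field, norm_div, sub_zero, div_le_iff₀ (norm_pos_iff.2 hz0), mul_comm]
  exact this

/-- The extremal case of the coefficient estimate for functions with non-negative real part. -/
theorem eqOn_of_deriv_zero_eq (hq : DifferentiableOn ℂ q disk) (hre : ∀ z ∈ disk, 0 ≤ (q z).re)
    {c : ℂ} (hc : ‖c‖ = 1) (hd : deriv q 0 = 2 * (q 0).re * c) {z : ℂ} (hz : z ∈ disk) :
    q z = (q 0).re * ((1 + c * z) / (1 - c * z)) + Complex.I * (q 0).im := by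
  have hda : DifferentiableAt ℂ q 0 := hq.differentiableAt (Metric.isOpen_ball.mem_nhds zero_mem_disk)
  have hcz : 1 - c * z ≠ 0 := by
    intro h
    have : ‖c * z‖ = 1 := by rw [← sub_eq_zero.1 h]; simp
    rw [norm_mul, hc, one_mul] at this
    exact absurd this (mem_ball_zero_iff.1 hz).ne
  have hre_im : q 0 = (q 0).re + (q 0).im * Complex.I := (Complex.re_add_im _).symm
  have hconj : conj (q 0) = (q 0).re - (q 0).im * Complex.I := by
    apply Complex.ext <;> simp
  rcases re_pos_or_const hq hre with h | ⟨k, hk⟩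
  · obtain ⟨hgd, hgm⟩ := cayley_props hq h
    have h0 := h 0 zero_mem_disk
    have hne : q 0 + conj (q 0) ≠ 0 := add_conj_ne_zero h0 h0
    have hsum : q 0 + conj (q 0) = 2 * (q 0).re := by rw [hconj]; linear_combination hre_im
    have hdg : deriv (fun z => (q z - q 0) / (q z + conj (q 0))) 0 = c := by
      have h1 := (hda.hasDerivAt.sub_const (q 0)).div (hda.hasDerivAt.add_const (conj (q 0))) hne
      refine h1.deriv.trans ?_
      rw [sub_self, zero_mul, sub_zero, hd, ← hsum]
      field_simp
    -- The Cayley transform has derivative `c` of modulus one at `0`, so by the equality case of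
    -- Schwarz's lemma it is `z ↦ c z`.
    have heq := Complex.affine_of_mapsTo_ball_of_norm_dslope_eq_div (R₂ := 1) hgd
      (by simpa using hgm) zero_mem_disk (by rw [dslope_same, hdg, hc]; norm_num) hz
    rw [dslope_same, hdg] at heq
    simp only [sub_self, zero_div, zero_add, sub_zero, smul_eq_mul] at heq
    rw [div_eq_iff (add_conj_ne_zero h0 (h z hz)), hconj] at heq
    field_simp
    linear_combination heq + hre_im
  · have hda0 : deriv q 0 = 0 := by
      have : q =ᶠ[𝓝 0] fun _ => k := by
        filter_upwards [Metric.isOpen_ball.mem_nhds zero_mem_disk] with w hw using hk w hw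
      rw [this.deriv_eq, deriv_const]
    have hc0 : c ≠ 0 := by rintro rfl; simp at hc
    rw [hda0] at hd
    have : ((q 0).re : ℂ) = 0 := by simpa [hc0] using hd.symm
    rw [this, zero_mul, zero_add, hk z hz, ← hk 0 zero_mem_disk]
    conv_lhs => rw [hre_im, this]
    ring

theorem norm_lt_one_of_mem_disk {z : ℂ} (hz : z ∈ disk) : ‖z‖ < 1 := mem_ball_zero_iff.1 hz

theorem sq_norm_one_sub_conj_mul_sub (z w : ℂ) :
    ‖1 - conj w * z‖ ^ 2 - ‖z - w‖ ^ 2 = (1 - ‖z‖ ^ 2) * (1 - ‖w‖ ^ 2) := by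
  simp only [← Complex.normSq_eq_norm_sq, Complex.normSq_apply]
  simp
  ring

theorem one_sub_conj_mul_ne_zero {z w : ℂ} (hz : z ∈ disk) (hw : w ∈ disk) :
    1 - conj w * z ≠ 0 := by
  intro h
  have h1 : ‖conj w * z‖ = 1 := by rw [← sub_eq_zero.1 h]; simp
  rw [norm_mul, Complex.norm_conj] at h1
  nlinarith [norm_lt_one_of_mem_disk hz, norm_lt_one_of_mem_disk hw, norm_nonneg z, norm_nonneg w]

theorem sub_div_one_sub_conj_mul_mem_disk {z w : ℂ} (hz : z ∈ disk) (hw : w ∈ disk) :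
    (z - w) / (1 - conj w * z) ∈ disk := by
  have hne := norm_pos_iff.2 (one_sub_conj_mul_ne_zero hz hw)
  rw [mem_ball_zero_iff, norm_div, div_lt_one hne]
  refine lt_of_pow_lt_pow_left₀ 2 hne.le ?_
  have := sq_norm_one_sub_conj_mul_sub z w
  have h1 : 0 < (1 - ‖z‖ ^ 2) * (1 - ‖w‖ ^ 2) := by
    have := pow_lt_one₀ (norm_nonneg z) (norm_lt_one_of_mem_disk hz) two_ne_zero
    have := pow_lt_one₀ (norm_nonneg w) (norm_lt_one_of_mem_disk hw) two_ne_zero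
    apply mul_pos <;> linarith
  linarith

/-- Harnack's inequality between two points of the disk. -/
theorem harnack (hq : DifferentiableOn ℂ q disk) (hre : ∀ z ∈ disk, 0 ≤ (q z).re) {z w : ℂ}
    (hz : z ∈ disk) (hw : w ∈ disk) :
    (q w).re * ((1 - ‖z‖ ^ 2) * (1 - ‖w‖ ^ 2)) ≤ 4 * (q z).re * ‖1 - conj w * z‖ ^ 2 := by
  set T : ℂ → ℂ := fun u => (u - -w) / (1 - conj (-w) * u) with hT
  have hw' : -w ∈ disk := by simpa using hw
  have hTm : MapsTo T disk disk := fun u hu => sub_div_one_sub_conj_mul_mem_disk hu hw'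
  have hTd : DifferentiableOn ℂ T disk :=
    (differentiableOn_id.sub_const _).div (by fun_prop) fun u hu => one_sub_conj_mul_ne_zero hu hw'
  set u := (z - w) / (1 - conj w * z) with hu
  have hud : u ∈ disk := sub_div_one_sub_conj_mul_mem_disk hz hw
  have hne := one_sub_conj_mul_ne_zero hz hw
  have hmul : u * (1 - conj w * z) = z - w := div_mul_cancel₀ _ hne
  have hTu : T u = z := by
    have h1 : 1 - conj (-w) * u ≠ 0 := one_sub_conj_mul_ne_zero hud hw'
    rw [hT]
    simp only
    rw [div_eq_iff h1, map_neg]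
    linear_combination hmul
  have h := re_zero_mul_one_sub_le (hq.comp hTd hTm) (fun v hv => hre _ (hTm hv)) hud
  have hT0 : T 0 = w := by simp [hT]
  simp only [Function.comp_apply, hTu, hT0] at h
  have hu1 := norm_lt_one_of_mem_disk hud
  have hu0 := norm_nonneg u
  have hqz := hre z hz
  -- The constant `4` bounds `(1 + |u|)²`; nothing is lost in Julia's lemma, where `|u| → 1`.
  have h2 : (q w).re * (1 - ‖u‖ ^ 2) ≤ 4 * (q z).re := by
    nlinarith [mul_le_mul_of_nonneg_right h (by positivity : 0 ≤ 1 + ‖u‖),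
      mul_nonneg hqz (mul_nonneg (sub_nonneg.2 hu1.le) (by positivity : 0 ≤ 3 + ‖u‖))]
  have h3 : (1 - ‖u‖ ^ 2) * ‖1 - conj w * z‖ ^ 2 = (1 - ‖z‖ ^ 2) * (1 - ‖w‖ ^ 2) := by
    rw [← sq_norm_one_sub_conj_mul_sub, ← hmul, norm_mul]
    ring
  rw [← h3, ← mul_assoc]
  gcongr

end HalfPlane

/-! ### Julia's lemma and removal of boundary point masses -/

theorem sub_ne_zero_of_mem_disk {σ z : ℂ} (hσ : ‖σ‖ = 1) (hz : z ∈ disk) : σ - z ≠ 0 := by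
  rw [sub_ne_zero]
  rintro rfl
  exact absurd hσ (mem_ball_zero_iff.1 hz).ne

theorem re_add_div_sub {σ : ℂ} (hσ : ‖σ‖ = 1) (z : ℂ) :
    ((σ + z) / (σ - z)).re = (1 - ‖z‖ ^ 2) / ‖σ - z‖ ^ 2 := by
  have h1 : (σ.re * σ.re + σ.im * σ.im) = 1 := by
    rw [← Complex.normSq_apply, Complex.normSq_eq_norm_sq, hσ, one_pow]
  rw [Complex.div_re, ← add_div, Complex.sq_norm, Complex.sq_norm]
  congr 1
  rw [Complex.normSq_apply]
  simp
  linear_combination h1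

theorem re_add_div_sub_pos {σ z : ℂ} (hσ : ‖σ‖ = 1) (hz : z ∈ disk) :
    0 < ((σ + z) / (σ - z)).re := by
  rw [re_add_div_sub hσ]
  have h1 := norm_pos_iff.2 (sub_ne_zero_of_mem_disk hσ hz)
  have h2 := pow_lt_one₀ (norm_nonneg z) (norm_lt_one_of_mem_disk hz) two_ne_zero
  apply div_pos <;> [linarith; positivity]

theorem ofReal_mul_mem_disk {σ : ℂ} (hσ : ‖σ‖ = 1) {r : ℝ} (h0 : 0 < r) (h1 : r < 1) :
    (r : ℂ) * σ ∈ disk := by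
  rw [mem_ball_zero_iff, norm_mul, hσ, mul_one, Complex.norm_real, Real.norm_of_nonneg h0.le]
  exact h1

theorem eventually_radius : ∀ᶠ r : ℝ in 𝓝[<] 1, 0 < r ∧ r < 1 := by
  filter_upwards [self_mem_nhdsWithin, mem_nhdsWithin_of_mem_nhds (Ioi_mem_nhds zero_lt_one)]
    with r h1 h0 using ⟨h0, h1⟩

/-- Julia's lemma for functions with non-negative real part. -/
theorem julia {q : ℂ → ℂ} (hq : DifferentiableOn ℂ q disk) (hre : ∀ z ∈ disk, 0 ≤ (q z).re)
    {σ : ℂ} (hσ : ‖σ‖ = 1) {m : ℝ}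
    (hm : Tendsto (fun r : ℝ => (1 - r : ℂ) * q (r * σ)) (𝓝[<] 1) (𝓝 (2 * m))) {z : ℂ}
    (hz : z ∈ disk) : 0 ≤ (q z - m * ((σ + z) / (σ - z))).re := by
  have hpos := norm_pos_iff.2 (sub_ne_zero_of_mem_disk hσ hz)
  have hL : Tendsto (fun r : ℝ => ((1 - r : ℂ) * q (r * σ)).re * ((1 + r) * (1 - ‖z‖ ^ 2)))
      (𝓝[<] 1) (𝓝 (2 * m * ((1 + 1) * (1 - ‖z‖ ^ 2)))) := by
    have h1 := (Complex.continuous_re.tendsto _).comp hm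
    have h2 : Tendsto (fun r : ℝ => (1 + r) * (1 - ‖z‖ ^ 2)) (𝓝[<] 1)
        (𝓝 ((1 + 1) * (1 - ‖z‖ ^ 2))) := by
      have : Continuous fun r : ℝ => (1 + r) * (1 - ‖z‖ ^ 2) := by fun_prop
      exact (this.tendsto 1).mono_left nhdsWithin_le_nhds
    have h3 : ((2 : ℂ) * m).re = 2 * m := by simp
    rw [← h3]
    exact h1.mul h2
  have hR : Tendsto (fun r : ℝ => 4 * (q z).re * ‖1 - conj ((r : ℂ) * σ) * z‖ ^ 2)
      (𝓝[<] 1) (𝓝 (4 * (q z).re * ‖σ - z‖ ^ 2)) := by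
    have : Continuous fun r : ℝ => 4 * (q z).re * ‖1 - conj ((r : ℂ) * σ) * z‖ ^ 2 := by
      have : Continuous fun r : ℝ => conj ((r : ℂ) * σ) :=
        Complex.continuous_conj.comp (by fun_prop)
      fun_prop
    have h2 := (this.tendsto 1).mono_left (nhdsWithin_le_nhds (s := Iio 1))
    have h3 : ‖1 - conj ((1 : ℝ) * σ) * z‖ = ‖σ - z‖ := by
      have h4 : σ * conj σ = 1 := by rw [Complex.mul_conj, Complex.normSq_eq_norm_sq, hσ]; simp
      have h5 : σ * (1 - conj ((1 : ℝ) * σ) * z) = σ - z := by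
        simp only [Complex.ofReal_one, one_mul]
        linear_combination (-z) * h4
      rw [← h5, norm_mul, hσ, one_mul]
    rwa [h3] at h2
  -- Harnack's inequality with `w = r σ`, in the limit `r → 1`.
  have hle : 2 * m * ((1 + 1) * (1 - ‖z‖ ^ 2)) ≤ 4 * (q z).re * ‖σ - z‖ ^ 2 := by
    refine le_of_tendsto_of_tendsto hL hR ?_
    filter_upwards [eventually_radius] with r ⟨h0, h1⟩
    have h := harnack hq hre hz (ofReal_mul_mem_disk hσ h0 h1)
    refine le_trans (le_of_eq ?_) h
    have h2 : ((1 - r : ℂ) * q (r * σ)).re = (1 - r) * (q (r * σ)).re := by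
      rw [← Complex.ofReal_one, ← Complex.ofReal_sub, Complex.re_ofReal_mul]
    rw [h2, norm_mul, hσ, Complex.norm_real, mul_one, Real.norm_of_nonneg h0.le]
    ring
  rw [Complex.sub_re, Complex.re_ofReal_mul, re_add_div_sub hσ, sub_nonneg, ← mul_div_assoc,
    div_le_iff₀ (by positivity)]
  linarith

/-- The terms already subtracted have poles away from `σ a`, so they do not change the radial limit
there, and Julia's lemma applies to the remainder. -/
theorem re_sub_sum_nonneg {f : ℂ → ℂ} (hf : DifferentiableOn ℂ f disk)
    (hre : ∀ z ∈ disk, 0 ≤ (f z).re) {ι : Type*} {σ : ι → ℂ} (hσ : ∀ k, ‖σ k‖ = 1)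
    (hinj : Function.Injective σ) {m : ι → ℝ}
    (hm : ∀ k, Tendsto (fun r : ℝ => (1 - r : ℂ) * f (r * σ k)) (𝓝[<] 1) (𝓝 (2 * m k)))
    (S : Finset ι) : ∀ z ∈ disk, 0 ≤ (f z - ∑ k ∈ S, (m k : ℂ) * ((σ k + z) / (σ k - z))).re := by
  classical
  induction S using Finset.induction_on with
  | empty => simpa using hre
  | insert a S ha ih =>
    intro z hz
    rw [Finset.sum_insert ha, add_comm, ← sub_sub]
    have hd : DifferentiableOn ℂ (fun z => f z - ∑ k ∈ S, (m k : ℂ) * ((σ k + z) / (σ k - z)))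
        disk := by
      refine hf.sub (DifferentiableOn.fun_sum fun k _ => ?_)
      refine DifferentiableOn.const_mul ?_ _
      exact (differentiableOn_id.const_add _).div (differentiableOn_id.const_sub _)
        fun w hw => sub_ne_zero_of_mem_disk (hσ k) hw
    refine julia hd ih (hσ a) ?_ hz
    have hrat : Tendsto (fun r : ℝ => (1 - r : ℂ) *
        ∑ k ∈ S, (m k : ℂ) * ((σ k + r * σ a) / (σ k - r * σ a))) (𝓝[<] 1) (𝓝 0) := by
      have hca : ContinuousAt (fun r : ℝ => (1 - r : ℂ) *
          ∑ k ∈ S, (m k : ℂ) * ((σ k + r * σ a) / (σ k - r * σ a))) 1 := by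
        refine ContinuousAt.mul (by fun_prop) (tendsto_finsetSum _ fun k hk => ?_)
        have hne : σ k - ((1 : ℝ) : ℂ) * σ a ≠ 0 := by
          rw [Complex.ofReal_one, one_mul, sub_ne_zero]
          intro h
          exact ha (hinj h ▸ hk)
        exact ContinuousAt.mul continuousAt_const (ContinuousAt.div (by fun_prop) (by fun_prop) hne)
      have := hca.tendsto.mono_left (nhdsWithin_le_nhds (s := Iio 1))
      simpa using this
    have := (hm a).sub hrat
    rw [sub_zero] at this
    refine this.congr fun r => ?_
    ring

theorem HasAngularLimit.radial {f : ℂ → ℂ} {σ l : ℂ} (hσ : ‖σ‖ = 1) (h : HasAngularLimit f σ l) :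
    Tendsto (fun r : ℝ => f (r * σ)) (𝓝[<] 1) (𝓝 l) := by
  refine (h 2).comp (tendsto_nhdsWithin_iff.2 ⟨?_, ?_⟩)
  · have : Continuous fun r : ℝ => (r : ℂ) * σ := by fun_prop
    simpa using (this.tendsto 1).mono_left (nhdsWithin_le_nhds (s := Iio 1))
  · filter_upwards [eventually_radius] with r ⟨h0, h1⟩
    refine ⟨ofReal_mul_mem_disk hσ h0 h1, ?_⟩
    have h2 : σ - r * σ = ((1 - r : ℝ) : ℂ) * σ := by push_cast; ring
    rw [h2, norm_mul, norm_mul, hσ, Complex.norm_real, Complex.norm_real, mul_one, mul_one,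
      Real.norm_of_nonneg h0.le, Real.norm_of_nonneg (sub_nonneg.2 h1.le)]
    linarith

theorem HasBoundarySpectralValue.tendsto_radial {G p : ℂ → ℂ} {σ : ℂ} {μ : ℝ} (hσ : ‖σ‖ = 1)
    (hGp : ∀ z ∈ disk, G z = -(z * p z)) (h : HasBoundarySpectralValue G σ μ) :
    Tendsto (fun r : ℝ => p (r * σ) / (1 - r : ℂ)) (𝓝[<] 1) (𝓝 (-μ)) := by
  have h1 := HasAngularLimit.radial hσ h
  have h2 : Tendsto (fun r : ℝ => -(r : ℂ)⁻¹) (𝓝[<] 1) (𝓝 (-1)) := by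
    have : ContinuousAt (fun r : ℝ => -(r : ℂ)⁻¹) 1 := by
      refine (ContinuousAt.inv₀ (by fun_prop) (by simp)).neg
    simpa using this.tendsto.mono_left (nhdsWithin_le_nhds (s := Iio 1))
  have h3 := h1.mul h2
  rw [mul_neg_one] at h3
  refine h3.congr' ?_
  filter_upwards [eventually_radius] with r ⟨h0, h1⟩
  rw [hGp _ (ofReal_mul_mem_disk hσ h0 h1)]
  have hσ0 : σ ≠ 0 := by rintro rfl; simp at hσ
  have hr0 : (r : ℂ) ≠ 0 := by exact_mod_cast h0.ne'
  have hr1 : (1 - r : ℂ) ≠ 0 := by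
    rw [sub_ne_zero]; exact_mod_cast h1.ne'
  have h2 : σ - r * σ = (1 - r) * σ := by ring
  rw [h2]
  field_simp

theorem nonpos_of_hasDerivWithinAt_of_le {f : ℝ → ℝ} {d : ℝ} (hf : HasDerivWithinAt f d (Ici 0) 0)
    (hle : ∀ t, 0 ≤ t → f t ≤ f 0) : d ≤ 0 := by
  have h := hasDerivWithinAt_iff_tendsto_slope.1 hf
  rw [Ici_sdiff_left] at h
  refine le_of_tendsto h ?_
  filter_upwards [self_mem_nhdsWithin] with t ht
  rw [slope_def_field, sub_zero]
  exact div_nonpos_of_nonpos_of_nonneg (sub_nonpos.2 (hle t (le_of_lt ht))) (le_of_lt ht)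

/-! ### The form of a generator in the class -/

section Representation

variable {G : ℂ → ℂ} {φ : ℝ → ℂ → ℂ}

theorem SemigroupDWPoint.apply_zero (hDW : SemigroupDWPoint φ 0) {t : ℝ} (ht : 0 ≤ t) :
    φ t 0 = 0 := by
  by_cases h : EqOn (φ t) id disk
  · exact h zero_mem_disk
  · rcases (hDW t ht h).2 with h | h
    · exact h.2
    · have := h.2.1.1
      simp at this

/-- By Schwarz's lemma `‖φ_t z‖² ≤ ‖z‖²`; differentiate at `t = 0`. -/
theorem IsGenerator.re_nonpos (hφ : IsGenerator G φ) (hDW : SemigroupDWPoint φ 0) {z : ℂ}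
    (hz : z ∈ disk) : (conj z * G z).re ≤ 0 := by
  have h0 := hφ.isSemigroup.zero z hz
  have h1 := (hφ.hasDeriv z hz 0 le_rfl).norm_sq
  rw [Complex.inner, h0, mul_comm (G z)] at h1
  have := nonpos_of_hasDerivWithinAt_of_le h1 fun t ht => by
    rw [h0]
    have := Complex.norm_le_norm_of_mapsTo_ball (hφ.isSemigroup.differentiableOn t ht)
      ((hφ.isSemigroup.mapsTo t ht).mono_right Metric.ball_subset_closedBall)
      (hDW.apply_zero ht) (mem_ball_zero_iff.1 hz)
    gcongr
  linarith

theorem IsGenerator.map_zero (hφ : IsGenerator G φ) (hDW : SemigroupDWPoint φ 0) : G 0 = 0 := by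
  have h1 := hφ.hasDeriv 0 zero_mem_disk 0 le_rfl
  rw [hDW.apply_zero le_rfl] at h1
  have h2 : HasDerivWithinAt (fun s => φ s 0) 0 (Ici 0) 0 :=
    (hasDerivWithinAt_const _ _ 0).congr (fun t ht => hDW.apply_zero ht) (hDW.apply_zero le_rfl)
  exact (uniqueDiffWithinAt_Ici (0 : ℝ)).eq_deriv _ h1 h2

/-- Berkson-Porta representation with respect to the origin. -/
theorem berksonPorta (hG : DifferentiableOn ℂ G disk) (h0 : G 0 = 0)
    (hre : ∀ z ∈ disk, (conj z * G z).re ≤ 0) :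
    ∃ p : ℂ → ℂ, DifferentiableOn ℂ p disk ∧ (∀ z ∈ disk, 0 ≤ (p z).re) ∧
      ∀ z, G z = -(z * p z) := by
  have hnhds : disk ∈ 𝓝 (0 : ℂ) := Metric.isOpen_ball.mem_nhds zero_mem_disk
  have hpd : DifferentiableOn ℂ (fun z => -dslope G 0 z) disk :=
    ((Complex.differentiableOn_dslope hnhds).2 hG).neg
  have hGp : ∀ z, G z = -(z * -dslope G 0 z) := fun z => by
    have := sub_smul_dslope G 0 z
    rw [sub_zero, h0, sub_zero, smul_eq_mul] at this
    rw [← this]; ring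
  have hne : ∀ z ∈ disk, z ≠ 0 → 0 ≤ (-dslope G 0 z).re := fun z hz hz0 => by
    have h1 := hre z hz
    have h2 : conj z * G z = ((-‖z‖ ^ 2 : ℝ) : ℂ) * -dslope G 0 z := by
      conv_lhs => rw [hGp z]
      have : conj z * z = ((‖z‖ ^ 2 : ℝ) : ℂ) := by
        rw [mul_comm, Complex.mul_conj, Complex.normSq_eq_norm_sq]
      push_cast at this ⊢
      linear_combination (dslope G 0 z) * this
    rw [h2, Complex.re_ofReal_mul] at h1
    have : 0 < ‖z‖ ^ 2 := by have := norm_pos_iff.2 hz0; positivity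
    nlinarith
  refine ⟨_, hpd, fun z hz => ?_, hGp⟩
  rcases eq_or_ne z 0 with rfl | hz0
  · have hc : ContinuousAt (fun z => (-dslope G 0 z).re) 0 :=
      Complex.continuous_re.continuousAt.comp (hpd.continuousOn.continuousAt hnhds)
    refine ge_of_tendsto (hc.tendsto.mono_left (nhdsWithin_le_nhds (s := {0}ᶜ))) ?_
    filter_upwards [self_mem_nhdsWithin, mem_nhdsWithin_of_mem_nhds hnhds] with w hw0 hw
      using hne w hw hw0
  · exact hne z hz hz0

section Structure

variable {n : ℕ} {σ : Fin n → ℂ} {Λ : Fin n → ℝ}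

theorem pZero_zero_eq (hσ : ∀ k, ‖σ k‖ = 1) (z : ℂ) :
    pZero 0 σ Λ z = ∑ k, ((1 / (2 * |Λ k|) : ℝ) : ℂ) * ((σ k + z) / (σ k - z)) := by
  simp [pZero, hσ]

theorem differentiableOn_pZero (hσ : ∀ k, ‖σ k‖ = 1) :
    DifferentiableOn ℂ (pZero 0 σ Λ) disk := by
  refine DifferentiableOn.fun_sum fun k _ => DifferentiableOn.const_mul ?_ _
  exact (differentiableOn_id.const_add _).div (differentiableOn_id.const_sub _)
    fun w hw => sub_ne_zero_of_mem_disk (hσ k) hw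

theorem re_pZero_pos (hn : 0 < n) (hσ : ∀ k, ‖σ k‖ = 1) (hΛ : ∀ k, Λ k < 0) {z : ℂ}
    (hz : z ∈ disk) : 0 < (pZero 0 σ Λ z).re := by
  have : Nonempty (Fin n) := ⟨⟨0, hn⟩⟩
  rw [pZero_zero_eq hσ, Complex.re_sum]
  refine Finset.sum_pos (fun k _ => ?_) Finset.univ_nonempty
  rw [Complex.re_ofReal_mul]
  have := abs_pos.2 (hΛ k).ne
  exact mul_pos (by positivity) (re_add_div_sub_pos (hσ k) hz)

/-- Membership in the class forces the representation `G = -z / (q + p₀)` with `Re q ≥ 0`. -/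
theorem exists_repr_of_mem_Gen (hn : 0 < n) (hσ : ∀ k, ‖σ k‖ = 1) (hinj : Function.Injective σ)
    (hΛ : ∀ k, Λ k < 0) (hG : G ∈ Gen 0 σ Λ) (hne : ¬ EqOn G 0 disk) :
    ∃ q : ℂ → ℂ, DifferentiableOn ℂ q disk ∧ (∀ z ∈ disk, 0 ≤ (q z).re) ∧
      ∀ z ∈ disk, G z = -(z / (q z + pZero 0 σ Λ z)) := by
  obtain ⟨φ, hφ, hDW, hk⟩ := hG
  obtain ⟨p, hpd, hpre, hGp⟩ := berksonPorta hφ.differentiableOn (hφ.map_zero hDW)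
    (fun z hz => hφ.re_nonpos hDW hz)
  have hrad : ∀ k, ∃ μ : ℝ, Λ k ≤ μ ∧ μ ≤ 0 ∧
      Tendsto (fun r : ℝ => p (r * σ k) / (1 - r : ℂ)) (𝓝[<] 1) (𝓝 (-μ)) := fun k => by
    obtain ⟨-, μ, h1, h2, h3⟩ := hk k
    exact ⟨μ, h1, h2, h3.tendsto_radial (hσ k) fun z _ => hGp z⟩
  have hlim0 : Tendsto (fun r : ℝ => (1 - r : ℂ)) (𝓝[<] 1) (𝓝 0) := by
    have : Continuous fun r : ℝ => (1 - r : ℂ) := by fun_prop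
    simpa using (this.tendsto 1).mono_left (nhdsWithin_le_nhds (s := Iio 1))
  have hr1 : ∀ r : ℝ, r < 1 → (1 - r : ℂ) ≠ 0 := fun r hr => by
    rw [sub_ne_zero]; exact_mod_cast hr.ne'
  have hpos : ∀ z ∈ disk, 0 < (p z).re := by
    -- A constant `p` must vanish, because `p (r σ) / (1 - r)` has a finite limit; then `G = 0`.
    rcases re_pos_or_const hpd hpre with h | ⟨c, hc⟩
    · exact h
    · exfalso
      obtain ⟨μ, -, -, hμ⟩ := hrad ⟨0, hn⟩
      have h1 := hμ.mul hlim0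
      rw [mul_zero] at h1
      have h2 : Tendsto (fun _ : ℝ => c) (𝓝[<] 1) (𝓝 0) := by
        refine h1.congr' ?_
        filter_upwards [eventually_radius] with r ⟨h0, h1⟩
        rw [hc _ (ofReal_mul_mem_disk (hσ _) h0 h1), div_mul_cancel₀ _ (hr1 r h1)]
      have hc0 : c = 0 := tendsto_nhds_unique tendsto_const_nhds h2
      refine hne fun z hz => ?_
      rw [hGp, hc z hz, hc0]
      simp
  have hp0 : ∀ z ∈ disk, p z ≠ 0 := fun z hz h => by
    have := hpos z hz
    rw [h] at this
    simp at this
  set f : ℂ → ℂ := fun z => (p z)⁻¹ with hf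
  have hfd : DifferentiableOn ℂ f disk := hpd.inv hp0
  have hfre : ∀ z ∈ disk, 0 ≤ (f z).re := fun z hz => by
    rw [hf, Complex.inv_re]
    exact div_nonneg (hpos z hz).le (Complex.normSq_nonneg _)
  have hm : ∀ k, ∃ m : ℝ, 1 / (2 * |Λ k|) ≤ m ∧
      Tendsto (fun r : ℝ => (1 - r : ℂ) * f (r * σ k)) (𝓝[<] 1) (𝓝 (2 * m)) := fun k => by
    obtain ⟨μ, hμ1, hμ2, hμ⟩ := hrad k
    -- If `μ = 0`, then `1/p` would grow faster than `1/(1 - r)` along the radius, against the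
    -- growth bound.
    have hμ0 : μ ≠ 0 := by
      rintro rfl
      have hb : Tendsto (fun r : ℝ => 2 * ‖f 0‖ * ‖p (r * σ k) / (1 - r : ℂ)‖) (𝓝[<] 1) (𝓝 0) := by
        simpa using hμ.norm.const_mul (2 * ‖f 0‖)
      have : (1 : ℝ) ≤ 0 := by
        refine ge_of_tendsto hb ?_
        filter_upwards [eventually_radius] with r ⟨h0, h1⟩
        have hd := ofReal_mul_mem_disk (hσ k) h0 h1
        have h2 := norm_mul_one_sub_le hfd hfre hd
        have h3 : ‖(r : ℂ) * σ k‖ = r := by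
          rw [norm_mul, hσ, mul_one, Complex.norm_real, Real.norm_of_nonneg h0.le]
        rw [h3, hf, norm_inv] at h2
        simp only at h2
        have h4 := norm_pos_iff.2 (hp0 _ hd)
        have h5 : ‖(1 - r : ℂ)‖ = 1 - r := by
          rw [← Complex.ofReal_one, ← Complex.ofReal_sub, Complex.norm_real,
            Real.norm_of_nonneg (by linarith)]
        rw [norm_div, h5, ← mul_div_assoc, le_div_iff₀ (by linarith), one_mul]
        rw [inv_mul_le_iff₀ h4] at h2
        have h6 := norm_nonneg (f 0)
        have h7 : ‖(p 0)⁻¹‖ = ‖f 0‖ := rfl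
        rw [h7] at h2
        refine h2.trans ?_
        have : 0 ≤ ‖p (r * σ k)‖ * ‖f 0‖ := by positivity
        nlinarith
      linarith
    have hμneg : μ < 0 := lt_of_le_of_ne hμ2 hμ0
    refine ⟨1 / (2 * |μ|), ?_, ?_⟩
    · have h1 : |μ| ≤ |Λ k| := by
        rw [abs_of_neg hμneg, abs_of_neg (hΛ k)]; linarith
      have := abs_pos.2 hμ0
      gcongr
    · have h1 : (-(μ : ℂ)) ≠ 0 := by simpa using hμ0
      have h2 := hμ.inv₀ h1
      have h3 : (-(μ : ℂ))⁻¹ = 2 * ((1 / (2 * |μ|) : ℝ) : ℂ) := by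
        rw [abs_of_neg hμneg]
        have : (μ : ℂ) ≠ 0 := by simpa using hμ0
        push_cast
        field_simp
      rw [h3] at h2
      refine h2.congr fun r => ?_
      rw [inv_div, div_eq_mul_inv]
  choose m hmle hm using hm
  refine ⟨fun z => f z - pZero 0 σ Λ z, hfd.sub (differentiableOn_pZero hσ), fun z hz => ?_,
    fun z hz => ?_⟩
  -- Replacing the full masses `m k` by the smaller `1/(2|Λ k|)` only adds non-negative multiples of
  -- Poisson kernels.
  · have h1 := re_sub_sum_nonneg hfd hfre hσ hinj hm Finset.univ z hz
    refine h1.trans ?_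
    rw [Complex.sub_re, Complex.sub_re, pZero_zero_eq hσ, Complex.re_sum, Complex.re_sum]
    refine sub_le_sub_left (Finset.sum_le_sum fun k _ => ?_) _
    rw [Complex.re_ofReal_mul, Complex.re_ofReal_mul]
    exact mul_le_mul_of_nonneg_right (hmle k) (re_add_div_sub_pos (hσ k) hz).le
  · rw [hGp, sub_add_cancel, hf]
    simp

end Structure

end Representation

/-- Serves sharpness in the exact class: the pole of the Möbius map must avoid all `σ k`. -/
theorem exists_norm_eq_one_forall_mul_ne_one {n : ℕ} (σ : Fin n → ℂ) :
    ∃ c : ℂ, ‖c‖ = 1 ∧ ∀ k, c * σ k ≠ 1 := by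
  have hpre : IsPreconnected (Metric.sphere (0 : ℂ) 1) :=
    isPreconnected_sphere (by rw [Complex.rank_real_complex]; norm_num) _ _
  have hinf : (Metric.sphere (0 : ℂ) 1).Infinite :=
    hpre.infinite_of_nontrivial ⟨1, by simp, -1, by simp, by norm_num⟩
  obtain ⟨c, hc, hcσ⟩ := hinf.exists_notMem_finite (Set.finite_range fun k => (σ k)⁻¹)
  refine ⟨c, by simpa using hc, fun k hk => hcσ ⟨k, ?_⟩⟩
  exact (eq_inv_of_mul_eq_one_left hk).symm

/-! ### Values at the origin and behaviour at boundary poles -/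

theorem deriv_zero_of_repr {G p : ℂ → ℂ} (hp : DifferentiableOn ℂ p disk)
    (hGp : ∀ z ∈ disk, G z = -(z * p z)) :
    deriv G 0 = -p 0 ∧ iteratedDeriv 2 G 0 = -(2 * deriv p 0) := by
  have hnhds : disk ∈ 𝓝 (0 : ℂ) := Metric.isOpen_ball.mem_nhds zero_mem_disk
  have hd : ∀ z ∈ disk, deriv G z = -(p z + z * deriv p z) := fun z hz => by
    have hz' := Metric.isOpen_ball.mem_nhds hz
    have heq : G =ᶠ[𝓝 z] fun z => -(z * p z) := by filter_upwards [hz'] with w hw using hGp w hw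
    rw [heq.deriv_eq]
    have := ((hasDerivAt_id z).mul (hp.differentiableAt hz').hasDerivAt).neg
    refine this.deriv.trans ?_
    simp
  have hp' : DifferentiableAt ℂ (deriv p) 0 := (hp.deriv Metric.isOpen_ball).differentiableAt hnhds
  refine ⟨by simpa using hd 0 zero_mem_disk, ?_⟩
  have heq : deriv G =ᶠ[𝓝 0] fun z => -(p z + z * deriv p z) := by
    filter_upwards [hnhds] with w hw using hd w hw
  rw [iteratedDeriv_succ, iteratedDeriv_one, heq.deriv_eq]
  have := ((hp.differentiableAt hnhds).hasDerivAt.add ((hasDerivAt_id 0).mul hp'.hasDerivAt)).neg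
  refine this.deriv.trans ?_
  simp
  ring

/-- Values at the origin of `-z / F` for a zero-free function `F`. -/
theorem deriv_zero_of_div_repr {G F : ℂ → ℂ} (hF : DifferentiableOn ℂ F disk)
    (hF0 : ∀ z ∈ disk, F z ≠ 0) (hGF : ∀ z ∈ disk, G z = -(z / F z)) :
    deriv G 0 = -(F 0)⁻¹ ∧ iteratedDeriv 2 G 0 = 2 * deriv F 0 / F 0 ^ 2 := by
  have hnhds : disk ∈ 𝓝 (0 : ℂ) := Metric.isOpen_ball.mem_nhds zero_mem_disk
  obtain ⟨h1, h2⟩ := deriv_zero_of_repr (G := G) (p := fun z => (F z)⁻¹) (hF.inv hF0)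
    (fun z hz => by rw [hGF z hz, div_eq_mul_inv])
  refine ⟨h1, h2.trans ?_⟩
  have := ((hF.differentiableAt hnhds).hasDerivAt.inv (hF0 0 zero_mem_disk)).deriv
  rw [show (fun z => (F z)⁻¹) = F⁻¹ from rfl, this]
  ring

theorem re_conj_mul_nonpos_of_div_repr {G F : ℂ → ℂ} (hF : ∀ z ∈ disk, 0 ≤ (F z).re)
    (hGF : ∀ z ∈ disk, G z = -(z / F z)) {z : ℂ} (hz : z ∈ disk) : (conj z * G z).re ≤ 0 := by
  have h : conj z * G z = ((-‖z‖ ^ 2 : ℝ) : ℂ) * (F z)⁻¹ := by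
    have : conj z * z = ((‖z‖ ^ 2 : ℝ) : ℂ) := by
      rw [mul_comm, Complex.mul_conj, Complex.normSq_eq_norm_sq]
    rw [hGF z hz, div_eq_mul_inv]
    push_cast at this ⊢
    linear_combination (-(F z)⁻¹) * this
  rw [h, Complex.re_ofReal_mul, Complex.inv_re]
  refine mul_nonpos_of_nonpos_of_nonneg (by simp) (div_nonneg (hF z hz) (Complex.normSq_nonneg _))

/-- If `-z / G` has a simple pole at the boundary point `σ`, then `σ` is a boundary regular fixed
point, and the spectral value is determined by the residue. -/
theorem IsGenerator.boundary_of_pole {G : ℂ → ℂ} {φ : ℝ → ℂ → ℂ} (hφ : IsGenerator G φ) {σ : ℂ}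
    (hσ : ‖σ‖ = 1) {R : ℂ → ℂ} {M : ℝ} (hM : 0 < M) (hR : AnalyticAt ℂ R σ)
    (hG : ∀ z ∈ disk, G z = -(z / (R z + M * ((σ + z) / (σ - z))))) :
    SemigroupBRFP φ σ ∧ HasBoundarySpectralValue G σ (-(1 / (2 * M))) := by
  -- Clearing the pole gives `G = -z (σ - z) / H` with `H σ = 2 M σ ≠ 0`, which is holomorphic near
  -- `σ` and vanishes there.
  set H : ℂ → ℂ := fun z => (σ - z) * R z + M * (σ + z) with hH
  have hσ0 : σ ≠ 0 := by rintro rfl; simp at hσ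
  have hM0 : (M : ℂ) ≠ 0 := by exact_mod_cast hM.ne'
  have hHσ : H σ = 2 * M * σ := by simp [hH]; ring
  have hHσ0 : H σ ≠ 0 := by rw [hHσ]; simp [hM.ne', hσ0]
  have hHa : AnalyticAt ℂ H σ := by fun_prop
  have hga : AnalyticAt ℂ (fun z => -(z * (σ - z) / H z)) σ :=
    (AnalyticAt.div (by fun_prop) hHa hHσ0).neg
  have hGH : ∀ z ∈ disk, G z = -(z * (σ - z) / H z) := fun z hz => by
    have hne := sub_ne_zero_of_mem_disk hσ hz
    have : R z + M * ((σ + z) / (σ - z)) = H z / (σ - z) := by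
      rw [hH]; field_simp
    rw [hG z hz, this, div_div_eq_mul_div]
  constructor
  · obtain ⟨U, hU, hUo, hσU⟩ := eventually_nhds_iff.1 hga.eventually_analyticAt
    exact hφ.semigroupBRFP hσ hUo hσU
      (fun z hz => (hU z hz).differentiableAt.differentiableWithinAt) (by simp)
      fun z hz _ => hGH z hz
  · refine hasAngularLimit_of_tendsto ?_
    have h1 : Tendsto (fun z => -(z / H z)) (𝓝[disk] σ) (𝓝 (-(σ / H σ))) :=
      ((continuousAt_id.div hHa.continuousAt hHσ0).neg.tendsto).mono_left nhdsWithin_le_nhds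
    have h2 : -(σ / H σ) = ((-(1 / (2 * M)) : ℝ) : ℂ) := by
      rw [hHσ]; push_cast; field_simp
    rw [h2] at h1
    refine h1.congr' ?_
    filter_upwards [self_mem_nhdsWithin] with z hz
    have hne := sub_ne_zero_of_mem_disk hσ hz
    rw [hGH z hz, neg_div, mul_div_right_comm, mul_div_assoc, div_self hne, mul_one]

/-! ### The Möbius family of generators -/

section Family

variable {n : ℕ} {σ : Fin n → ℂ} {Λ : Fin n → ℝ}

/-- The functions `-z / (q + p₀)` with `q` a Möbius map of the disk into the closed right
half-plane. -/
noncomputable def moebiusGenerator (σ : Fin n → ℂ) (Λ : Fin n → ℝ) (A B : ℝ) (c z : ℂ) : ℂ :=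
  -(z / (A * ((1 + c * z) / (1 - c * z)) + Complex.I * B + pZero 0 σ Λ z))

theorem mul_mem_disk {c z : ℂ} (hc : ‖c‖ ≤ 1) (hz : z ∈ disk) : c * z ∈ disk := by
  rw [mem_ball_zero_iff, norm_mul]
  have := norm_lt_one_of_mem_disk hz
  nlinarith [norm_nonneg z, norm_nonneg c]

theorem one_sub_mul_ne_zero {c z : ℂ} (hc : ‖c‖ ≤ 1) (hz : z ∈ disk) : 1 - c * z ≠ 0 :=
  sub_ne_zero_of_mem_disk norm_one (mul_mem_disk hc hz)

theorem differentiableOn_moebius {A B : ℝ} {c : ℂ} (hc : ‖c‖ ≤ 1) :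
    DifferentiableOn ℂ (fun z => A * ((1 + c * z) / (1 - c * z)) + Complex.I * B) disk :=
  (DifferentiableOn.const_mul (DifferentiableOn.div (by fun_prop) (by fun_prop)
    fun _ hz => one_sub_mul_ne_zero hc hz) _).add_const _

theorem re_moebius_nonneg {A B : ℝ} (hA : 0 ≤ A) {c z : ℂ} (hc : ‖c‖ ≤ 1) (hz : z ∈ disk) :
    0 ≤ (A * ((1 + c * z) / (1 - c * z)) + Complex.I * B).re := by
  rw [Complex.add_re, Complex.re_ofReal_mul]
  have := mul_nonneg hA (re_add_div_sub_pos norm_one (mul_mem_disk hc hz)).le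
  simpa using this

theorem hasDerivAt_moebius_zero (A B : ℝ) (c : ℂ) :
    HasDerivAt (fun z => A * ((1 + c * z) / (1 - c * z)) + Complex.I * B) (2 * A * c) 0 := by
  have h1 : HasDerivAt (fun z : ℂ => c * z) c 0 := by
    simpa using (hasDerivAt_id (0 : ℂ)).const_mul c
  have h2 := (((h1.const_add 1).div (h1.const_sub 1) (by simp)).const_mul (A : ℂ)).add_const
    (Complex.I * B)
  refine h2.congr_deriv ?_
  simp
  ring

theorem hasDerivAt_pZero_zero (hσ : ∀ k, ‖σ k‖ = 1) :
    HasDerivAt (pZero 0 σ Λ) (∑ k, conj (σ k) / ((|Λ k| : ℝ) : ℂ)) 0 := by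
  rw [show pZero 0 σ Λ = _ from funext (pZero_zero_eq hσ)]
  refine HasDerivAt.fun_sum fun k _ => ?_
  have hσ0 : σ k ≠ 0 := by intro h; have := hσ k; simp [h] at this
  have h1 := (((hasDerivAt_id (0 : ℂ)).const_add (σ k)).div ((hasDerivAt_id (0 : ℂ)).const_sub (σ k))
    (by simpa using hσ0)).const_mul ((1 / (2 * |Λ k|) : ℝ) : ℂ)
  refine h1.congr_deriv ?_
  have h2 : conj (σ k) = (σ k)⁻¹ := by
    rw [Complex.inv_def, Complex.normSq_eq_norm_sq, hσ]; simp
  rw [h2]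
  push_cast
  simp
  field_simp
  ring

theorem pZero_zero_zero (hσ : ∀ k, ‖σ k‖ = 1) : pZero 0 σ Λ 0 = ((invSum Λ / 2 : ℝ) : ℂ) := by
  rw [pZero_zero_eq hσ, invSum, Finset.sum_div, Complex.ofReal_sum]
  refine Finset.sum_congr rfl fun k _ => ?_
  have hσ0 : σ k ≠ 0 := by intro h; have := hσ k; simp [h] at this
  rw [add_zero, sub_zero, div_self hσ0, mul_one]
  congr 1
  rw [one_div, mul_inv]
  ring

/-- The functions of the Möbius family belong to the class; the spectral value at `σ k` is extremal
unless the Möbius map has its pole there. -/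
theorem exists_isGenerator_moebius (hn : 0 < n) (hσ : ∀ k, ‖σ k‖ = 1)
    (hinj : Function.Injective σ) (hΛ : ∀ k, Λ k < 0) {A B : ℝ} (hA : 0 ≤ A) {c : ℂ}
    (hc : ‖c‖ ≤ 1) :
    ∃ φ, IsGenerator (moebiusGenerator σ Λ A B c) φ ∧ SemigroupDWPoint φ 0 ∧
      ∀ k, SemigroupBRFP φ (σ k) ∧ ∃ μ : ℝ, Λ k ≤ μ ∧ μ ≤ 0 ∧ (c * σ k ≠ 1 → μ = Λ k) ∧
        HasBoundarySpectralValue (moebiusGenerator σ Λ A B c) (σ k) μ := by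
  set F : ℂ → ℂ := fun z => A * ((1 + c * z) / (1 - c * z)) + Complex.I * B + pZero 0 σ Λ z
  have hFd : DifferentiableOn ℂ F disk :=
    (differentiableOn_moebius hc).add (differentiableOn_pZero hσ)
  have hFre : ∀ z ∈ disk, 0 < (F z).re := fun z hz => by
    rw [Complex.add_re]
    exact add_pos_of_nonneg_of_pos (re_moebius_nonneg hA hc hz) (re_pZero_pos hn hσ hΛ hz)
  have hF0 : ∀ z ∈ disk, F z ≠ 0 := fun z hz h => by
    have := hFre z hz
    rw [h] at this
    simp at this
  have hre : ∀ z ∈ disk, (conj z * moebiusGenerator σ Λ A B c z).re ≤ 0 := fun z hz =>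
    re_conj_mul_nonpos_of_div_repr (fun w hw => (hFre w hw).le) (fun _ _ => rfl) hz
  obtain ⟨φ, hφ⟩ := exists_isGenerator (G := moebiusGenerator σ Λ A B c)
    ((differentiableOn_id.div hFd hF0).neg) hre
  refine ⟨φ, hφ, hφ.semigroupDWPoint hre, fun k => ?_⟩
  have hΛk := abs_pos.2 (hΛ k).ne
  set m : ℝ := 1 / (2 * |Λ k|) with hm
  have hm0 : 0 < m := by positivity
  set P : ℂ → ℂ := fun z => ∑ j ∈ Finset.univ.erase k,
    ((1 / (2 * |Λ j|) : ℝ) : ℂ) * ((σ j + z) / (σ j - z)) with hP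
  have hPa : AnalyticAt ℂ P (σ k) := by
    refine Finset.analyticAt_fun_sum _ fun j hj => ?_
    refine analyticAt_const.mul (AnalyticAt.div (by fun_prop) (by fun_prop) ?_)
    rw [sub_ne_zero]
    exact fun h => (Finset.ne_of_mem_erase hj) (hinj h)
  have hsplit : ∀ z, pZero 0 σ Λ z = P z + m * ((σ k + z) / (σ k - z)) := fun z => by
    rw [pZero_zero_eq hσ, hP, hm]
    exact (Finset.sum_erase_add _ _ (Finset.mem_univ k)).symm
  -- If the Möbius pole sits at `σ k`, the masses add up to `m + A` and the spectral value moves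
  -- from `Λ k` towards zero; otherwise the mass is exactly `m = 1/(2|Λ k|)`.
  by_cases hck : c * σ k = 1
  · have hpole := hφ.boundary_of_pole (hσ k) (R := fun z => Complex.I * B + P z)
      (M := m + A) (by positivity) (by fun_prop) fun z hz => by
        have h1 : (1 + c * z) / (1 - c * z) = (σ k + z) / (σ k - z) := by
          rw [div_eq_div_iff (one_sub_mul_ne_zero hc hz) (sub_ne_zero_of_mem_disk (hσ k) hz)]
          linear_combination (2 * z) * hck
        rw [moebiusGenerator, hsplit, h1]
        congr 2
        push_cast
        ring
    refine ⟨hpole.1, _, ?_, ?_, fun h => absurd hck h, hpole.2⟩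
    · have h1 : 1 / (2 * (m + A)) ≤ 1 / (2 * m) := by gcongr; linarith
      have h2 : 1 / (2 * m) = -Λ k := by
        rw [hm, abs_of_neg (hΛ k)]
        have := (hΛ k).ne
        field_simp
      linarith
    · have : 0 < 1 / (2 * (m + A)) := by positivity
      linarith
  · have hne : 1 - c * σ k ≠ 0 := sub_ne_zero.2 (Ne.symm hck)
    have hpole := hφ.boundary_of_pole (hσ k)
      (R := fun z => A * ((1 + c * z) / (1 - c * z)) + Complex.I * B + P z)
      (M := m) hm0 (by
        refine AnalyticAt.add (AnalyticAt.add (analyticAt_const.mul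
          (AnalyticAt.div (by fun_prop) (by fun_prop) hne)) analyticAt_const) hPa) fun z hz => by
        rw [moebiusGenerator, hsplit, ← add_assoc]
    have h2 : -(1 / (2 * m)) = Λ k := by
      rw [hm, abs_of_neg (hΛ k)]
      have := (hΛ k).ne
      field_simp
    exact ⟨hpole.1, _, h2.ge, h2.trans_le (hΛ k).le, fun _ => h2, hpole.2⟩

end Family

variable {n : ℕ} {σ : Fin n → ℂ} {Λ : Fin n → ℝ}

/-! ### The disk of spectral values and the shape of the region -/

theorem invSum_pos (hn : 0 < n) (hΛ : ∀ k, Λ k < 0) : 0 < invSum Λ := by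
  have : Nonempty (Fin n) := ⟨⟨0, hn⟩⟩
  exact Finset.sum_pos (fun k _ => inv_pos.2 (abs_pos.2 (hΛ k).ne)) Finset.univ_nonempty

theorem sq_norm_sub_ofReal (w : ℂ) (r : ℝ) : ‖w - r‖ ^ 2 = ‖w‖ ^ 2 - 2 * r * w.re + r ^ 2 := by
  rw [Complex.sq_norm, Complex.sq_norm, Complex.normSq_apply, Complex.normSq_apply]
  simp
  ring

theorem Omega_eq_closedBall : Omega Λ = Metric.closedBall (((invSum Λ)⁻¹ : ℝ) : ℂ) (invSum Λ)⁻¹ := by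
  ext w
  rw [Metric.mem_closedBall, dist_eq_norm]
  rfl

theorem mem_Omega_iff (hI : 0 < invSum Λ) {w : ℂ} :
    w ∈ Omega Λ ↔ invSum Λ * ‖w‖ ^ 2 ≤ 2 * w.re := by
  have hr : 0 < (invSum Λ)⁻¹ := inv_pos.2 hI
  have hrI : invSum Λ * (invSum Λ)⁻¹ = 1 := mul_inv_cancel₀ hI.ne'
  rw [Omega_eq_closedBall, Metric.mem_closedBall, dist_eq_norm,
    ← pow_le_pow_iff_left₀ (norm_nonneg _) hr.le two_ne_zero, sq_norm_sub_ofReal,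
    add_le_iff_nonpos_left, sub_nonpos, ← mul_le_mul_iff_right₀ hI]
  rw [show invSum Λ * (2 * (invSum Λ)⁻¹ * w.re) = 2 * w.re by linear_combination 2 * w.re * hrI]

theorem mem_interior_Omega_iff (hI : 0 < invSum Λ) {w : ℂ} :
    w ∈ interior (Omega Λ) ↔ invSum Λ * ‖w‖ ^ 2 < 2 * w.re := by
  have hr : 0 < (invSum Λ)⁻¹ := inv_pos.2 hI
  have hrI : invSum Λ * (invSum Λ)⁻¹ = 1 := mul_inv_cancel₀ hI.ne'
  rw [Omega_eq_closedBall, interior_closedBall _ hr.ne', Metric.mem_ball, dist_eq_norm,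
    ← pow_lt_pow_iff_left₀ (norm_nonneg _) hr.le two_ne_zero, sq_norm_sub_ofReal,
    add_lt_iff_neg_right, sub_neg, ← mul_lt_mul_iff_right₀ hI]
  rw [show invSum Λ * (2 * (invSum Λ)⁻¹ * w.re) = 2 * w.re by linear_combination 2 * w.re * hrI]

theorem mem_frontier_Omega_iff (hI : 0 < invSum Λ) {w : ℂ} :
    w ∈ frontier (Omega Λ) ↔ invSum Λ * ‖w‖ ^ 2 = 2 * w.re := by
  have hcl : IsClosed (Omega Λ) := by rw [Omega_eq_closedBall]; exact Metric.isClosed_closedBall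
  rw [hcl.frontier_eq, Set.mem_sdiff, mem_Omega_iff hI, mem_interior_Omega_iff hI, not_lt]
  exact ⟨fun h => le_antisymm h.1 h.2, fun h => ⟨h.le, h.ge⟩⟩

theorem re_ell (w : ℂ) : (ell Λ w).re = (1 / w).re - invSum Λ / 2 := by
  rw [ell, Complex.sub_re, Complex.ofReal_re]

theorem re_ell_mul {w : ℂ} (hw : w ≠ 0) :
    2 * (ell Λ w).re * ‖w‖ ^ 2 = 2 * w.re - invSum Λ * ‖w‖ ^ 2 := by
  have : ‖w‖ ^ 2 ≠ 0 := by simpa using hw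
  rw [re_ell, one_div, Complex.inv_re, Complex.normSq_eq_norm_sq]
  field_simp

/-- Inversion maps `Ω` without `0` to the half-plane `Re (1/w) ≥ invSum Λ / 2`. -/
theorem re_ell_nonneg_iff (hI : 0 < invSum Λ) {w : ℂ} (hw : w ≠ 0) :
    0 ≤ (ell Λ w).re ↔ w ∈ Omega Λ := by
  have h1 : 0 < ‖w‖ ^ 2 := by have := norm_pos_iff.2 hw; positivity
  have h2 := re_ell_mul (Λ := Λ) hw
  rw [mem_Omega_iff hI]
  constructor <;> intro h
  · nlinarith [mul_nonneg h h1.le]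
  · by_contra hc
    nlinarith [mul_pos (neg_pos.2 (not_le.1 hc)) h1]

theorem sum_one_div_eq_invSum : ∑ k, 1 / |Λ k| = invSum Λ := by simp [invSum]

theorem two_mul_re_ell (w : ℂ) : 2 * (ell Λ w).re = 2 * (1 / w).re - invSum Λ := by
  rw [re_ell]; ring

/-- The signed defect of the inequality that describes the value region. -/
noncomputable def regionGap (σ : Fin n → ℂ) (Λ : Fin n → ℝ) (p : ℂ × ℂ) : ℝ :=
  4 * p.2.re - 2 * invSum Λ * ‖p.2‖ ^ 2
    - ‖p.1 - 2 * p.2 ^ 2 * ∑ k, conj (σ k) / ((|Λ k| : ℝ) : ℂ)‖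

theorem continuous_regionGap : Continuous (regionGap σ Λ) := by
  unfold regionGap
  fun_prop

/-- Clearing the denominator by `2|ω|²` makes the defect continuous on all of `ℂ²`; at `ω = 0` it
reads `-|ζ|`, which encodes `Z_0 = {0}`. -/
theorem regionGap_eq_of_ne_zero {p : ℂ × ℂ} (hp : p.2 ≠ 0) :
    regionGap σ Λ p = 2 * ‖p.2‖ ^ 2 * (2 * (ell Λ p.2).re
      - ‖p.1 / (2 * p.2 ^ 2) - ∑ k, conj (σ k) / ((|Λ k| : ℝ) : ℂ)‖) := by
  have h1 := re_ell_mul (Λ := Λ) hp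
  set S := ∑ k, conj (σ k) / ((|Λ k| : ℝ) : ℂ)
  have h2 : p.1 - 2 * p.2 ^ 2 * S = 2 * p.2 ^ 2 * (p.1 / (2 * p.2 ^ 2) - S) := by
    field_simp
  rw [regionGap, h2, norm_mul]
  have h3 : ‖2 * p.2 ^ 2‖ = 2 * ‖p.2‖ ^ 2 := by simp
  rw [h3]
  linear_combination (-2) * h1

theorem mem_region_iff (hI : 0 < invSum Λ) (p : ℂ × ℂ) :
    (p.2 ∈ Omega Λ ∧ p.1 ∈ ZDisk σ Λ p.2) ↔ 0 ≤ regionGap σ Λ p := by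
  rcases eq_or_ne p.2 0 with h0 | h0
  · have h1 : p.2 ∈ Omega Λ := by rw [mem_Omega_iff hI, h0]; simp
    have h2 : p.1 ∈ ZDisk σ Λ p.2 ↔ p.1 = 0 := by simp [ZDisk, h0]
    rw [h2, regionGap, h0]
    simpa [h0] using fun _ => h0 ▸ h1
  · have hpos : 0 < 2 * ‖p.2‖ ^ 2 := by have := norm_pos_iff.2 h0; positivity
    rw [regionGap_eq_of_ne_zero h0, mul_nonneg_iff_of_pos_left hpos, sub_nonneg, two_mul_re_ell]
    constructor
    · rintro ⟨-, h | h⟩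
      · exact absurd h.1 h0
      · exact h.2
    · intro h
      refine ⟨?_, Or.inr ⟨h0, h⟩⟩
      rw [← re_ell_nonneg_iff hI h0]
      have := (norm_nonneg _).trans h
      rw [← two_mul_re_ell] at this
      linarith

/-- Where the gap vanishes, moving `ζ` radially away from the centre `c` of its fibre, with `ω`
fixed, makes the gap negative. At the centre itself any direction serves, so fibres reduced to a
point are included. -/
theorem frontier_region :
    frontier {p : ℂ × ℂ | 0 ≤ regionGap σ Λ p} = {p | regionGap σ Λ p = 0} := by
  have hcl : IsClosed {p : ℂ × ℂ | 0 ≤ regionGap σ Λ p} :=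
    isClosed_le continuous_const continuous_regionGap
  ext p
  rw [hcl.frontier_eq, Set.mem_sdiff]
  constructor
  · rintro ⟨h1, h2⟩
    refine le_antisymm (not_lt.1 fun h => h2 ?_) h1
    refine mem_interior.2 ⟨{p | 0 < regionGap σ Λ p}, fun q hq => ?_,
      isOpen_lt continuous_const continuous_regionGap, h⟩
    rw [mem_ofPred_eq] at hq ⊢
    exact hq.le
  · intro h
    rw [mem_ofPred_eq] at h
    refine ⟨h.ge, fun hint => ?_⟩
    set c := 2 * p.2 ^ 2 * ∑ k, conj (σ k) / ((|Λ k| : ℝ) : ℂ) with hc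
    obtain ⟨u, hu, hpu⟩ : ∃ u : ℂ, ‖u‖ = 1 ∧ p.1 - c = ‖p.1 - c‖ * u := by
      rcases eq_or_ne (p.1 - c) 0 with h0 | h0
      · exact ⟨1, norm_one, by simp [h0]⟩
      · have h1 := norm_pos_iff.2 h0
        refine ⟨(p.1 - c) / ‖p.1 - c‖, ?_, ?_⟩
        · rw [norm_div, Complex.norm_real, norm_norm, div_self h1.ne']
        · rw [mul_div_cancel₀]
          exact_mod_cast h1.ne'
    have hcont : Continuous fun t : ℝ => (p.1 + t * u, p.2) := by fun_prop
    have h0 : (fun t : ℝ => (p.1 + t * u, p.2)) 0 = p := by simp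
    have hev : ∀ᶠ t : ℝ in 𝓝[>] 0, (p.1 + t * u, p.2) ∈ {p : ℂ × ℂ | 0 ≤ regionGap σ Λ p} :=
      ((hcont.tendsto' 0 p h0).mono_left nhdsWithin_le_nhds).eventually
        (mem_interior_iff_mem_nhds.1 hint)
    obtain ⟨t, ht, ht0⟩ := (hev.and self_mem_nhdsWithin).exists
    have h1 : p.1 + t * u - c = ((‖p.1 - c‖ + t : ℝ) : ℂ) * u := by
      push_cast
      linear_combination hpu
    have h2 : ‖p.1 + t * u - c‖ = ‖p.1 - c‖ + t := by
      rw [h1, norm_mul, hu, mul_one, Complex.norm_real, Real.norm_of_nonneg (by positivity)]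
    simp only [mem_ofPred_eq, regionGap, ← hc, h2] at ht
    simp only [regionGap, ← hc] at h
    linarith

/-! ### Value pairs in the class and the extremal functions -/

theorem isGenerator_zero : IsGenerator (fun _ => 0) fun _ z => z where
  isSemigroup :=
    { differentiableOn := fun _ _ => differentiableOn_id
      mapsTo := fun _ _ => mapsTo_id _
      zero := fun _ _ => rfl
      add := fun _ _ _ _ _ _ => rfl
      tendsto := fun _ _ => tendsto_const_nhds }
  differentiableOn := differentiableOn_const _
  hasDeriv := fun _ _ _ _ => hasDerivWithinAt_const _ _ _

theorem zero_mem_Gen (hσ : ∀ k, ‖σ k‖ = 1) (hΛ : ∀ k, Λ k < 0) : (fun _ => 0) ∈ Gen 0 σ Λ := by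
  refine ⟨_, isGenerator_zero, fun t _ h => absurd (fun _ _ => rfl) h, fun k => ⟨?_, 0, (hΛ k).le,
    le_rfl, ?_⟩⟩
  · exact isGenerator_zero.semigroupBRFP (hσ k) isOpen_univ (mem_univ _)
      (differentiableOn_const 0) rfl fun _ _ _ => rfl
  · intro M
    simpa using tendsto_const_nhds

/-- The pair of values of a generator that vanishes on the disk. -/
theorem valuePair_eq_zero_of_eqOn {G : ℂ → ℂ} {φ : ℝ → ℂ → ℂ} (hφ : IsGenerator G φ)
    (h : EqOn G 0 disk) : valuePair G = 0 := by
  have h1 := deriv_zero_of_repr (G := G) (p := fun _ => 0) (differentiableOn_const _)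
    fun z hz => by simpa using h hz
  have h2 := hφ.spectralValue_eq fun z hz => by simp [h hz]
  rw [valuePair, h2, h1.1, h1.2]
  simp

/-- With `F = q + p₀` one has `λ = 1/F(0)` and `G''(0) = 2 F'(0)/F(0)²`; solving for `q(0)` and
`q'(0)` translates the value pair into the first two coefficients of `q`. -/
theorem valuePair_of_repr (hn : 0 < n) (hσ : ∀ k, ‖σ k‖ = 1) (hΛ : ∀ k, Λ k < 0) {G q : ℂ → ℂ}
    {φ : ℝ → ℂ → ℂ} (hφ : IsGenerator G φ) (hq : DifferentiableOn ℂ q disk)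
    (hre : ∀ z ∈ disk, 0 ≤ (q z).re) (hG : ∀ z ∈ disk, G z = -(z / (q z + pZero 0 σ Λ z))) :
    spectralValue G 0 ≠ 0 ∧ q 0 = ell Λ (spectralValue G 0) ∧
      deriv q 0 = iteratedDeriv 2 G 0 / (2 * spectralValue G 0 ^ 2)
        - ∑ k, conj (σ k) / ((|Λ k| : ℝ) : ℂ) := by
  have hFre : ∀ z ∈ disk, 0 < (q z + pZero 0 σ Λ z).re := fun z hz => by
    rw [Complex.add_re]
    exact add_pos_of_nonneg_of_pos (hre z hz) (re_pZero_pos hn hσ hΛ hz)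
  have hF0 : ∀ z ∈ disk, q z + pZero 0 σ Λ z ≠ 0 := fun z hz h => by
    have := hFre z hz
    rw [h] at this
    simp at this
  obtain ⟨h1, h2⟩ := deriv_zero_of_div_repr (hq.add (differentiableOn_pZero hσ)) hF0 hG
  have h3 := hφ.spectralValue_eq fun z hz =>
    re_conj_mul_nonpos_of_div_repr (fun w hw => (hFre w hw).le) hG hz
  have hd : deriv (q + pZero 0 σ Λ) 0 = deriv q 0 + ∑ k, conj (σ k) / ((|Λ k| : ℝ) : ℂ) :=
    ((hq.differentiableAt (Metric.isOpen_ball.mem_nhds zero_mem_disk)).hasDerivAt.add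
      (hasDerivAt_pZero_zero hσ)).deriv
  have h00 := hF0 0 zero_mem_disk
  rw [h1, neg_neg] at h3
  simp only [Pi.add_apply] at h2 h3
  rw [hd] at h2
  rw [h3, h2]
  refine ⟨inv_ne_zero h00, ?_, ?_⟩
  · rw [ell, one_div, inv_inv, ← pZero_zero_zero hσ]
    ring
  · field_simp
    ring

theorem ell_injective : Function.Injective (ell Λ) := fun a b h => by
  unfold ell at h
  have := sub_left_injective h
  simpa using this

theorem moebiusGenerator_values (hn : 0 < n) (hσ : ∀ k, ‖σ k‖ = 1)
    (hinj : Function.Injective σ) (hΛ : ∀ k, Λ k < 0) {ω c : ℂ} (hω : ω ∈ Omega Λ) (hω0 : ω ≠ 0)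
    (hc : ‖c‖ ≤ 1) :
    moebiusGenerator σ Λ (ell Λ ω).re (ell Λ ω).im c ∈ Gen 0 σ Λ ∧
      spectralValue (moebiusGenerator σ Λ (ell Λ ω).re (ell Λ ω).im c) 0 = ω ∧
      iteratedDeriv 2 (moebiusGenerator σ Λ (ell Λ ω).re (ell Λ ω).im c) 0 / (2 * ω ^ 2)
        - ∑ k, conj (σ k) / ((|Λ k| : ℝ) : ℂ) = 2 * (ell Λ ω).re * c ∧
      ((∀ k, c * σ k ≠ 1) →
        moebiusGenerator σ Λ (ell Λ ω).re (ell Λ ω).im c ∈ GenExact 0 σ Λ) := by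
  have hA := (re_ell_nonneg_iff (invSum_pos hn hΛ) hω0).2 hω
  obtain ⟨φ, hφ, hDW, hk⟩ := exists_isGenerator_moebius hn hσ hinj hΛ hA (B := (ell Λ ω).im) hc
  obtain ⟨h1, h2, h3⟩ := valuePair_of_repr hn hσ hΛ hφ (differentiableOn_moebius hc)
    (fun z hz => re_moebius_nonneg hA hc hz) (fun _ _ => rfl)
  rw [(hasDerivAt_moebius_zero _ _ _).deriv] at h3
  have h4 : spectralValue (moebiusGenerator σ Λ (ell Λ ω).re (ell Λ ω).im c) 0 = ω := by
    have h5 : ell Λ ω = ell Λ (spectralValue (moebiusGenerator σ Λ (ell Λ ω).re (ell Λ ω).im c) 0) := by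
      rw [← h2]
      conv_lhs => rw [← Complex.re_add_im (ell Λ ω)]
      simp [mul_comm]
    exact (ell_injective h5).symm
  rw [h4] at h3
  refine ⟨⟨φ, hφ, hDW, fun k => ?_⟩, h4, h3.symm, fun hne => ⟨φ, hφ, hDW, fun k => ?_⟩⟩
  · obtain ⟨hb, μ, h5, h6, -, h7⟩ := hk k
    exact ⟨hb, μ, h5, h6, h7⟩
  · obtain ⟨hb, μ, -, -, h6, h7⟩ := hk k
    exact ⟨hb, h6 (hne k) ▸ h7⟩

theorem isExtremal_zero_iff (hn : 0 < n) (hΛ : ∀ k, Λ k < 0) {E : ℂ → ℂ} :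
    IsExtremal σ Λ 0 E ↔ E = fun _ => 0 := by
  have h : (0 : ℂ) ∉ interior (Omega Λ) := by
    rw [mem_interior_Omega_iff (invSum_pos hn hΛ)]
    simp
  simp [IsExtremal, h]

theorem re_ell_eq_zero_iff (hI : 0 < invSum Λ) {ω : ℂ} (hω0 : ω ≠ 0) :
    (ell Λ ω).re = 0 ↔ ω ∈ frontier (Omega Λ) := by
  have h1 := re_ell_mul (Λ := Λ) hω0
  have h2 : ‖ω‖ ^ 2 ≠ 0 := by simpa using hω0
  rw [mem_frontier_Omega_iff hI]
  constructor <;> intro h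
  · rw [h] at h1
    linarith
  · rw [h, sub_self] at h1
    simpa [h2] using h1

theorem extremalInt_eq {ω s : ℂ} (hs : ‖s‖ = 1) :
    extremalInt σ Λ ω s = moebiusGenerator σ Λ (ell Λ ω).re (ell Λ ω).im (conj s) := by
  have h1 : s * conj s = 1 := by rw [Complex.mul_conj, Complex.normSq_eq_norm_sq, hs]; simp
  have h0 : s ≠ 0 := by rintro rfl; simp at hs
  funext z
  have h2 : (s + z) / (s - z) = (1 + conj s * z) / (1 - conj s * z) := by
    rw [show s + z = s * (1 + conj s * z) by linear_combination (-z) * h1,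
      show s - z = s * (1 - conj s * z) by linear_combination z * h1, mul_div_mul_left _ _ h0]
  rw [extremalInt, moebiusGenerator, h2, mul_comm ((1 + conj s * z) / (1 - conj s * z))]

theorem extremalBdry_eq (hI : 0 < invSum Λ) {ω : ℂ} (hω0 : ω ≠ 0) (hω : ω ∈ frontier (Omega Λ))
    (c : ℂ) :
    extremalBdry σ Λ ω = moebiusGenerator σ Λ (ell Λ ω).re (ell Λ ω).im c := by
  funext z
  rw [extremalBdry, moebiusGenerator, (re_ell_eq_zero_iff hI hω0).2 hω]
  simp

/-- Both nonzero shapes are Möbius generators with `|c| = 1`: inside `Ω` take `c = conj s`, and on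
its boundary `Re ell = 0` makes `c` irrelevant. -/
theorem isExtremal_iff (hI : 0 < invSum Λ) {ω : ℂ} (hω0 : ω ≠ 0) {E : ℂ → ℂ} :
    IsExtremal σ Λ ω E ↔ ω ∈ Omega Λ ∧ ∃ c : ℂ, ‖c‖ = 1 ∧
      E = moebiusGenerator σ Λ (ell Λ ω).re (ell Λ ω).im c := by
  have hcl : IsClosed (Omega Λ) := by rw [Omega_eq_closedBall]; exact Metric.isClosed_closedBall
  constructor
  · rintro (⟨h, s, hs, rfl⟩ | ⟨h, -, rfl⟩ | ⟨h, -⟩)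
    · exact ⟨interior_subset h, conj s, by simpa using hs, extremalInt_eq hs⟩
    · exact ⟨hcl.frontier_subset h, 1, norm_one, extremalBdry_eq hI hω0 h 1⟩
    · exact absurd h hω0
  · rintro ⟨h, c, hc, rfl⟩
    by_cases hint : ω ∈ interior (Omega Λ)
    · have hc' : ‖conj c‖ = 1 := by simpa using hc
      refine Or.inl ⟨hint, conj c, hc', ?_⟩
      rw [extremalInt_eq hc', Complex.conj_conj]
    · have hfr : ω ∈ frontier (Omega Λ) := by rw [hcl.frontier_eq]; exact ⟨h, hint⟩
      exact Or.inr (Or.inl ⟨hfr, hω0, (extremalBdry_eq hI hω0 hfr c).symm⟩)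

theorem valuePair_mem_region (hn : 0 < n) (hσ : ∀ k, ‖σ k‖ = 1) (hinj : Function.Injective σ)
    (hΛ : ∀ k, Λ k < 0) {G : ℂ → ℂ} (hG : G ∈ Gen 0 σ Λ) :
    0 ≤ regionGap σ Λ (valuePair G) := by
  by_cases h : EqOn G 0 disk
  · obtain ⟨φ, hφ, -⟩ := hG
    rw [valuePair_eq_zero_of_eqOn hφ h]
    simp [regionGap]
  · obtain ⟨q, hq, hre, hrep⟩ := exists_repr_of_mem_Gen hn hσ hinj hΛ hG h
    obtain ⟨φ, hφ, -⟩ := hG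
    obtain ⟨h1, h2, h3⟩ := valuePair_of_repr hn hσ hΛ hφ hq hre hrep
    rw [regionGap_eq_of_ne_zero h1]
    refine mul_nonneg (by positivity) (sub_nonneg.2 ?_)
    have := norm_deriv_zero_le hq hre
    rw [h2, h3] at this
    exact this

theorem exists_moebius_parameter {w : ℂ} {A : ℝ} (h : ‖w‖ ≤ 2 * A) :
    ∃ c : ℂ, ‖c‖ ≤ 1 ∧ 2 * A * c = w := by
  rcases eq_or_ne A 0 with rfl | hA
  · have : w = 0 := by simpa using h
    exact ⟨0, by simp, by simp [this]⟩
  · have hA0 : 0 < 2 * A := lt_of_le_of_ne ((norm_nonneg _).trans h) (mul_ne_zero two_ne_zero hA).symm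
    have hA' : (A : ℂ) ≠ 0 := by exact_mod_cast hA
    refine ⟨w / (2 * A : ℝ), ?_, by push_cast; field_simp⟩
    rw [norm_div, Complex.norm_real, Real.norm_of_nonneg hA0.le]
    exact div_le_one_of_le₀ h hA0.le

theorem exists_unimodular_moebius_parameter {w : ℂ} {A : ℝ} (h : ‖w‖ = 2 * A) :
    ∃ c : ℂ, ‖c‖ = 1 ∧ 2 * A * c = w := by
  rcases eq_or_ne A 0 with rfl | hA
  · have : w = 0 := by simpa using h
    exact ⟨1, by simp, by simp [this]⟩
  · obtain ⟨c, -, hc⟩ := exists_moebius_parameter h.le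
    refine ⟨c, ?_, hc⟩
    have h1 : 2 * A * ‖c‖ = 2 * A := by
      have hA0 : 0 ≤ A := by have := norm_nonneg w; linarith
      calc 2 * A * ‖c‖ = ‖2 * (A : ℂ) * c‖ := by simp [abs_of_nonneg hA0]
        _ = 2 * A := by rw [hc, h]
    exact mul_left_cancel₀ (mul_ne_zero two_ne_zero hA) (h1.trans (mul_one _).symm)

theorem valuePair_moebiusGenerator (hn : 0 < n) (hσ : ∀ k, ‖σ k‖ = 1)
    (hinj : Function.Injective σ) (hΛ : ∀ k, Λ k < 0) {p : ℂ × ℂ} (hω : p.2 ∈ Omega Λ)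
    (hω0 : p.2 ≠ 0) {c : ℂ} (hc : ‖c‖ ≤ 1)
    (hcp : 2 * (ell Λ p.2).re * c
      = p.1 / (2 * p.2 ^ 2) - ∑ k, conj (σ k) / ((|Λ k| : ℝ) : ℂ)) :
    valuePair (moebiusGenerator σ Λ (ell Λ p.2).re (ell Λ p.2).im c) = p := by
  obtain ⟨-, h2, h3, -⟩ := moebiusGenerator_values hn hσ hinj hΛ hω hω0 hc
  rw [hcp] at h3
  have h4 := sub_left_injective h3
  have h5 : (2 * p.2 ^ 2) ≠ 0 := mul_ne_zero two_ne_zero (pow_ne_zero 2 hω0)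
  exact Prod.ext ((div_left_inj' h5).1 h4) h2

/-! ### The value region, its boundary and uniqueness -/

theorem valueRegion_eq (hn : 0 < n) (hσ : ∀ k, ‖σ k‖ = 1) (hinj : Function.Injective σ)
    (hΛ : ∀ k, Λ k < 0) : valueRegion σ Λ = {p : ℂ × ℂ | 0 ≤ regionGap σ Λ p} := by
  have hI := invSum_pos hn hΛ
  refine Subset.antisymm ?_ ?_
  · rintro _ ⟨G, hG, rfl⟩
    exact valuePair_mem_region hn hσ hinj hΛ hG
  · intro p hp
    rw [mem_ofPred_eq] at hp
    rcases eq_or_ne p.2 0 with h0 | h0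
    · refine ⟨_, zero_mem_Gen hσ hΛ, ?_⟩
      rw [valuePair_eq_zero_of_eqOn isGenerator_zero fun _ _ => rfl]
      have h1 : p.1 = 0 := by simpa [regionGap, h0] using hp
      exact (Prod.ext h1 h0).symm
    · have hω := ((mem_region_iff hI p).2 hp).1
      have hpos : 0 < 2 * ‖p.2‖ ^ 2 := by have := norm_pos_iff.2 h0; positivity
      rw [regionGap_eq_of_ne_zero h0, mul_nonneg_iff_of_pos_left hpos, sub_nonneg] at hp
      obtain ⟨c, hc, hcp⟩ := exists_moebius_parameter hp
      exact ⟨_, (moebiusGenerator_values hn hσ hinj hΛ hω h0 hc).1,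
        valuePair_moebiusGenerator hn hσ hinj hΛ hω h0 hc hcp⟩

theorem frontier_valueRegion (hn : 0 < n) (hσ : ∀ k, ‖σ k‖ = 1) (hinj : Function.Injective σ)
    (hΛ : ∀ k, Λ k < 0) : frontier (valueRegion σ Λ) = {p : ℂ × ℂ | regionGap σ Λ p = 0} := by
  rw [valueRegion_eq hn hσ hinj hΛ, frontier_region]

/-- Uniqueness of the generator that delivers a boundary point of the value region. -/
theorem eqOn_moebiusGenerator (hn : 0 < n) (hσ : ∀ k, ‖σ k‖ = 1) (hinj : Function.Injective σ)
    (hΛ : ∀ k, Λ k < 0) {G : ℂ → ℂ} (hG : G ∈ Gen 0 σ Λ) {p : ℂ × ℂ} (hp : p.2 ≠ 0) {c : ℂ}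
    (hc : ‖c‖ = 1)
    (hcp : 2 * (ell Λ p.2).re * c
      = p.1 / (2 * p.2 ^ 2) - ∑ k, conj (σ k) / ((|Λ k| : ℝ) : ℂ)) (hGp : valuePair G = p) :
    EqOn G (moebiusGenerator σ Λ (ell Λ p.2).re (ell Λ p.2).im c) disk := by
  have hne : ¬ EqOn G 0 disk := fun h => by
    obtain ⟨φ, hφ, -⟩ := hG
    rw [valuePair_eq_zero_of_eqOn hφ h] at hGp
    exact hp (by rw [← hGp]; rfl)
  obtain ⟨q, hq, hre, hrep⟩ := exists_repr_of_mem_Gen hn hσ hinj hΛ hG hne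
  obtain ⟨φ, hφ, -⟩ := hG
  obtain ⟨-, h2, h3⟩ := valuePair_of_repr hn hσ hΛ hφ hq hre hrep
  have h4 : iteratedDeriv 2 G 0 = p.1 := congrArg Prod.fst hGp
  have h5 : spectralValue G 0 = p.2 := congrArg Prod.snd hGp
  rw [h5] at h2 h3
  rw [h4, ← hcp, ← h2] at h3
  intro z hz
  rw [hrep z hz, eqOn_of_deriv_zero_eq hq hre hc h3 hz, moebiusGenerator, h2]

end DiskSemigroup

open DiskSemigroup in
theorem mainTheorem3 {n : ℕ} (hn : 0 < n) (σ : Fin n → ℂ) (Λ : Fin n → ℝ)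
    (hσ : ∀ k, ‖σ k‖ = 1) (hinj : Function.Injective σ) (hΛ : ∀ k, Λ k < 0) :
    -- the spectral value of each generator in the class is well defined
    (∀ G ∈ Gen 0 σ Λ, ∃! l : ℂ, IsSpectralValue G 0 l) ∧
    -- the value region
    valueRegion σ Λ = {p : ℂ × ℂ | p.2 ∈ Omega Λ ∧ p.1 ∈ ZDisk σ Λ p.2} ∧
    -- each boundary point is delivered by a unique generator, and that one is in the list
    (∀ p ∈ frontier (valueRegion σ Λ), ∃ E ∈ Gen 0 σ Λ,
      IsExtremal σ Λ p.2 E ∧ valuePair E = p ∧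
        ∀ G ∈ Gen 0 σ Λ, valuePair G = p → EqOn G E disk) ∧
    -- each function in the list belongs to the class and delivers a boundary point
    (∀ (ω : ℂ) (E : ℂ → ℂ), IsExtremal σ Λ ω E →
      E ∈ Gen 0 σ Λ ∧ spectralValue E 0 = ω ∧ valuePair E ∈ frontier (valueRegion σ Λ)) ∧
    -- the inequality
    (∀ G ∈ Gen 0 σ Λ, ¬ EqOn G 0 disk →
      spectralValue G 0 ≠ 0 ∧
      ‖iteratedDeriv 2 G 0 / (2 * spectralValue G 0 ^ 2)
          - ∑ k, conj (σ k) / ((|Λ k| : ℝ) : ℂ)‖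
        ≤ 2 * (1 / spectralValue G 0).re - ∑ k, 1 / |Λ k|) ∧
    -- its sharpness, for every nonzero spectral value and with prescribed boundary spectral values
    (∀ ω ∈ Omega Λ, ω ≠ 0 → ∃ G ∈ GenExact 0 σ Λ, spectralValue G 0 = ω ∧
      ‖iteratedDeriv 2 G 0 / (2 * ω ^ 2) - ∑ k, conj (σ k) / ((|Λ k| : ℝ) : ℂ)‖
        = 2 * (1 / ω).re - ∑ k, 1 / |Λ k|) := by
  have hI := invSum_pos hn hΛ
  have hineq : ∀ G ∈ Gen 0 σ Λ, ¬ EqOn G 0 disk →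
      spectralValue G 0 ≠ 0 ∧
      ‖iteratedDeriv 2 G 0 / (2 * spectralValue G 0 ^ 2)
          - ∑ k, conj (σ k) / ((|Λ k| : ℝ) : ℂ)‖
        ≤ 2 * (1 / spectralValue G 0).re - ∑ k, 1 / |Λ k| := by
    intro G hG hne
    obtain ⟨q, hq, hre, hrep⟩ := exists_repr_of_mem_Gen hn hσ hinj hΛ hG hne
    obtain ⟨φ, hφ, -⟩ := hG
    obtain ⟨h1, h2, h3⟩ := valuePair_of_repr hn hσ hΛ hφ hq hre hrep
    refine ⟨h1, ?_⟩
    have := norm_deriv_zero_le hq hre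
    rwa [h2, h3, two_mul_re_ell, ← sum_one_div_eq_invSum] at this
  refine ⟨?_, ?_, ?_, ?_, hineq, ?_⟩
  · rintro G ⟨φ, hφ, hDW, -⟩
    have hre := fun z (hz : z ∈ disk) => hφ.re_nonpos hDW hz
    exact ⟨_, (hφ.isSpectralValue_iff hre).2 rfl, fun l hl => (hφ.isSpectralValue_iff hre).1 hl⟩
  · rw [valueRegion_eq hn hσ hinj hΛ]
    ext p
    exact (mem_region_iff hI p).symm
  · intro p hp
    rw [frontier_valueRegion hn hσ hinj hΛ, mem_ofPred_eq] at hp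
    rcases eq_or_ne p.2 0 with h0 | h0
    · have h1 : p.1 = 0 := by simpa [regionGap, h0] using hp
      refine ⟨_, zero_mem_Gen hσ hΛ, ?_, ?_, ?_⟩
      · rw [h0, isExtremal_zero_iff hn hΛ]
      · rw [valuePair_eq_zero_of_eqOn isGenerator_zero fun _ _ => rfl]
        exact (Prod.ext h1 h0).symm
      · intro G hG hGp
        -- A nonzero generator has a nonzero spectral value, so only the zero generator lies over `ω
        -- = 0`.
        by_contra hne
        exact (hineq G hG hne).1 ((congrArg Prod.snd hGp).trans h0)
    · have hω := ((mem_region_iff hI p).2 hp.ge).1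
      have hpos : 2 * ‖p.2‖ ^ 2 ≠ 0 := by have := norm_pos_iff.2 h0; positivity
      rw [regionGap_eq_of_ne_zero h0, mul_eq_zero, or_iff_right hpos, sub_eq_zero] at hp
      obtain ⟨c, hc, hcp⟩ := exists_unimodular_moebius_parameter hp.symm
      exact ⟨_, (moebiusGenerator_values hn hσ hinj hΛ hω h0 hc.le).1,
        (isExtremal_iff hI h0).2 ⟨hω, c, hc, rfl⟩,
        valuePair_moebiusGenerator hn hσ hinj hΛ hω h0 hc.le hcp,
        fun G hG hGp => eqOn_moebiusGenerator hn hσ hinj hΛ hG h0 hc hcp hGp⟩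
  · intro ω E hE
    rw [frontier_valueRegion hn hσ hinj hΛ, mem_ofPred_eq]
    rcases eq_or_ne ω 0 with rfl | h0
    · rw [isExtremal_zero_iff hn hΛ] at hE
      subst hE
      have h1 := valuePair_eq_zero_of_eqOn isGenerator_zero fun _ _ => rfl
      refine ⟨zero_mem_Gen hσ hΛ, congrArg Prod.snd h1, ?_⟩
      rw [h1]
      simp [regionGap]
    · obtain ⟨hω, c, hc, rfl⟩ := (isExtremal_iff hI h0).1 hE
      obtain ⟨h1, h2, h3, -⟩ := moebiusGenerator_values hn hσ hinj hΛ hω h0 hc.le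
      refine ⟨h1, h2, ?_⟩
      have hA := (re_ell_nonneg_iff hI h0).2 hω
      have h4 : (valuePair (moebiusGenerator σ Λ (ell Λ ω).re (ell Λ ω).im c)).2 = ω := h2
      rw [regionGap_eq_of_ne_zero (by rwa [h4]), h4]
      simp only [valuePair]
      rw [h3]
      simp [hc, abs_of_nonneg hA]
  · intro ω hω h0
    -- `|c| = 1` gives equality, and `c σ_k ≠ 1` keeps the Möbius term from adding mass at `σ_k`, so
    -- the spectral values are exactly `Λ k`.
    obtain ⟨c, hc, hcσ⟩ := exists_norm_eq_one_forall_mul_ne_one σ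
    obtain ⟨-, h2, h3, h4⟩ := moebiusGenerator_values hn hσ hinj hΛ hω h0 hc.le
    refine ⟨_, h4 hcσ, h2, ?_⟩
    have hA := (re_ell_nonneg_iff hI h0).2 hω
    rw [h3, sum_one_div_eq_invSum, ← two_mul_re_ell]
    simp [hc, abs_of_nonneg hA]
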